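/- Notation. For $b>0$ and an entire function $f:\mathbb C\to\mathbb C$ put $\|f\|_b=\sup_{k\ge 0} b^{-k}|f^{(k)}(0)|$. For $a\ge 0$ let $\mathcal A_a$ be the space of all entire $f$ with $\|f\|_b<\infty$ for every $b>a$, equipped with the topology defined by the family of norms $\|\cdot\|_b$, $b>a$. Let $\mathcal L^+$ (the Laguerre entire functions) be the set of all entire functions of the form $$f(z)=C z^m e^{\alpha z}\prod_{j=1}^\infty(1+\beta_j z),\qquad C\in\mathbb C,\ m\in\mathbb N_0,\ \alpha\ge 0,\ \beta_j\ge\beta_{j+1}\ge 0,\ \sum_{j}\beta_j<\infty,$$ and let $\mathcal L^+_a=\mathcal L^+\cap\mathcal A_a$ carry the topology induced from $\mathcal A_a$. With $D=d/dz$ let $$\Delta_{\theta,\omega}=(\theta+zD)D+\omega zD,\qquad (\varphi(\Delta_{\theta,\omega})f)(z)=\sum_{k=0}^\infty\frac{\varphi^{(k)}(0)}{k!}\,(\Delta_{\theta,\omega}^k f)(z).$$ The expression $\omega^{-1}(e^{a\omega}-1)$ is understood as its limit $a$ when $\omega=0$. Theorem. Let $\theta\ge 0$, $\omega\ge 0$,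 $a\ge 0$, $b\ge 0$ satisfy $b\,\omega^{-1}(e^{a\omega}-1)<1$, and put $$c=b\,e^{a\omega}\bigl(1-b\,\omega^{-1}(e^{a\omega}-1)\bigr)^{-1}.$$ Then for all $\varphi\in\mathcal L^+_a$ and $f\in\mathcal L^+_b$ the series defining $(\varphi(\Delta_{\theta,\omega})f)(z)$ converges absolutely for every $z\in\mathbb C$, its sum $\varphi(\Delta_{\theta,\omega})f$ belongs to $\mathcal L^+_c$, and $(\varphi,f)\mapsto\varphi(\Delta_{\theta,\omega})f$ is a continuous map from $\mathcal L^+_a\times\mathcal L^+_b$ into $\mathcal L^+_c$. -/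

import Mathlib

noncomputable section

/-- The differential expression `Δ_{θ,ω} = (θ + z D) D + ω z D`. -/
def lagDelta (θ ω : ℝ) (f : ℂ → ℂ) : ℂ → ℂ :=
  fun z => (θ : ℂ) * deriv f z + z * deriv (deriv f) z + (ω : ℂ) * z * deriv f z

/-- The norm `‖f‖_b = sup_k b^{-k} |f^{(k)}(0)|`; it is only used for functions for which the
supremum is finite. -/
def expNorm (b : ℝ) (f : ℂ → ℂ) : ℝ :=
  ⨆ k : ℕ, (b ^ k)⁻¹ * ‖iteratedDeriv k f 0‖

/-- The assertion `‖f‖_b < ∞`. -/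
def ExpNormFinite (b : ℝ) (f : ℂ → ℂ) : Prop :=
  BddAbove (Set.range fun k : ℕ => (b ^ k)⁻¹ * ‖iteratedDeriv k f 0‖)

theorem iteratedDeriv_add_of_entire {f g : ℂ → ℂ} (hf : Differentiable ℂ f)
    (hg : Differentiable ℂ g) (k : ℕ) :
    iteratedDeriv k (f + g) 0 = iteratedDeriv k f 0 + iteratedDeriv k g 0 :=
  iteratedDeriv_add hf.contDiff.contDiffAt hg.contDiff.contDiffAt

theorem iteratedDeriv_smul_at_zero (f : ℂ → ℂ) (c : ℂ) (k : ℕ) :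
    iteratedDeriv k (c • f) 0 = c * iteratedDeriv k f 0 := by
  rw [iteratedDeriv_const_smul_field, smul_eq_mul]

theorem expNormFinite_add {b : ℝ} (hb : 0 < b) {f g : ℂ → ℂ} (hf : Differentiable ℂ f)
    (hg : Differentiable ℂ g) (hf' : ExpNormFinite b f) (hg' : ExpNormFinite b g) :
    ExpNormFinite b (f + g) := by
  obtain ⟨M, hM⟩ := hf'
  obtain ⟨N, hN⟩ := hg'
  refine ⟨M + N, ?_⟩
  rintro _ ⟨k, rfl⟩
  have h1 := hM ⟨k, rfl⟩
  have h2 := hN ⟨k, rfl⟩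
  have h3 : (b ^ k)⁻¹ * ‖iteratedDeriv k (f + g) 0‖ ≤
      (b ^ k)⁻¹ * (‖iteratedDeriv k f 0‖ + ‖iteratedDeriv k g 0‖) := by
    rw [iteratedDeriv_add_of_entire hf hg]
    gcongr
    exact norm_add_le _ _
  simp only at h1 h2 ⊢
  linarith

theorem expNormFinite_smul {b : ℝ} {f : ℂ → ℂ} (hf' : ExpNormFinite b f) (c : ℂ) : ExpNormFinite b (c • f) := by
  obtain ⟨M, hM⟩ := hf'
  refine ⟨‖c‖ * M, ?_⟩
  rintro _ ⟨k, rfl⟩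
  have h1 := mul_le_mul_of_nonneg_left (hM ⟨k, rfl⟩) (norm_nonneg c)
  simp only [iteratedDeriv_smul_at_zero, norm_mul] at h1 ⊢
  linarith

/-- The entire functions `f` with `‖f‖_b < ∞` for all `b > a`, as a vector space. (For `a ≥ 0` the
condition `0 < b` is implied by `a < b`.) -/
def expTypeSubmodule (a : ℝ) : Submodule ℂ (ℂ → ℂ) where
  carrier := {f | Differentiable ℂ f ∧ ∀ b : ℝ, 0 < b → a < b → ExpNormFinite b f}
  add_mem' := fun hf hg =>
    ⟨hf.1.add hg.1, fun b hb hab => expNormFinite_add hb hf.1 hg.1 (hf.2 b hb hab) (hg.2 b hb hab)⟩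
  zero_mem' := by
    refine ⟨differentiable_const 0, fun b _ _ => ⟨0, ?_⟩⟩
    rintro _ ⟨k, rfl⟩
    simp
  smul_mem' := fun c _ hf =>
    ⟨hf.1.const_smul c, fun b hb hab => expNormFinite_smul (hf.2 b hb hab) c⟩

/-- The space `𝒜_a`, a type of its own so that it does not inherit the topology of pointwise
convergence from `ℂ → ℂ`. -/
def ExpType (a : ℝ) : Type := expTypeSubmodule a

instance (a : ℝ) : AddCommGroup (ExpType a) := inferInstanceAs (AddCommGroup (expTypeSubmodule a))

instance (a : ℝ) : Module ℂ (ExpType a) := inferInstanceAs (Module ℂ (expTypeSubmodule a))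

instance (a : ℝ) : CoeFun (ExpType a) (fun _ => ℂ → ℂ) := ⟨fun f => f.1⟩

/-- The norm `‖·‖_b` on `𝒜_a`, for `b > a`. -/
def expSeminorm (a : ℝ) (b : {b : ℝ // 0 < b ∧ a < b}) : Seminorm ℂ (ExpType a) :=
  Seminorm.of (fun f => expNorm b f)
    (by
      intro f g
      have hf := f.2.2 b b.2.1 b.2.2
      have hg := g.2.2 b b.2.1 b.2.2
      refine ciSup_le fun k => ?_
      have h1 := le_ciSup hf k
      have h2 := le_ciSup hg k
      have hb : (0 : ℝ) < b := b.2.1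
      have h3 : ((b : ℝ) ^ k)⁻¹ * ‖iteratedDeriv k (f.1 + g.1) 0‖ ≤
          ((b : ℝ) ^ k)⁻¹ * (‖iteratedDeriv k f.1 0‖ + ‖iteratedDeriv k g.1 0‖) := by
        rw [iteratedDeriv_add_of_entire f.2.1 g.2.1]
        gcongr
        exact norm_add_le _ _
      change ((b : ℝ) ^ k)⁻¹ * ‖iteratedDeriv k (f.1 + g.1) 0‖ ≤ expNorm b f.1 + expNorm b g.1
      simp only [expNorm]
      linarith)
    (by
      intro c f
      change expNorm b (c • f.1) = ‖c‖ * expNorm b f.1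
      simp only [expNorm]
      rw [Real.mul_iSup_of_nonneg (norm_nonneg c)]
      congr 1
      funext k
      rw [iteratedDeriv_smul_at_zero, norm_mul]
      ring)

instance (a : ℝ) : Nonempty {b : ℝ // 0 < b ∧ a < b} :=
  ⟨⟨max a 0 + 1, by have := le_max_right a 0; linarith, by have := le_max_left a 0; linarith⟩⟩

/-- The topology `𝒯_a` defined by the norms `‖·‖_b`, `b > a`. -/
instance (a : ℝ) : TopologicalSpace (ExpType a) :=
  (SeminormFamily.moduleFilterBasis (𝕜 := ℂ) (expSeminorm a)).topology

theorem expType_withSeminorms (a : ℝ) : WithSeminorms (𝕜 := ℂ) (expSeminorm a) := ⟨rfl⟩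

/-- Laguerre entire functions: `f(z) = C z^m e^{α z} ∏_j (1 + β_j z)` with `C ∈ ℂ`, `m ∈ ℕ₀`,
`α ≥ 0`, `β_j ≥ β_{j+1} ≥ 0` and `∑ β_j < ∞`. -/
def IsLaguerreEntire (f : ℂ → ℂ) : Prop :=
  ∃ (C : ℂ) (m : ℕ) (α : ℝ) (β : ℕ → ℝ), 0 ≤ α ∧ Antitone β ∧ (∀ j, 0 ≤ β j) ∧ Summable β ∧
    ∀ z : ℂ, f z = C * z ^ m * Complex.exp (α * z) * ∏' j, (1 + (β j : ℂ) * z)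

/-- The set `ℒ⁺_a = ℒ⁺ ∩ 𝒜_a`, a subset of the topological space `𝒜_a`. -/
def laguerrePlus (a : ℝ) : Set (ExpType a) := {f | IsLaguerreEntire f}

/-- `ω⁻¹ (e^{aω} - 1)`, understood as its limit `a` when `ω = 0`. -/
def expQuot (a ω : ℝ) : ℝ := if ω = 0 then a else ω⁻¹ * (Real.exp (a * ω) - 1)

/-- `c(b) = b e^{aω} (1 - b ω⁻¹ (e^{aω} - 1))⁻¹`. -/
def outType (a ω b : ℝ) : ℝ := b * Real.exp (a * ω) * (1 - b * expQuot a ω)⁻¹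

/-- The `k`-th term of the series `∑_k φ^{(k)}(0) / k! · (Δ_{θ,ω}^k f)(z)` that defines
`(φ(Δ_{θ,ω}) f)(z)`. -/
def opTerm (θ ω : ℝ) (φ f : ℂ → ℂ) (z : ℂ) (k : ℕ) : ℂ :=
  iteratedDeriv k φ 0 / (k.factorial : ℂ) * ((lagDelta θ ω)^[k] f) z

end

/-!
On sequences of derivatives at `0`, `Δ_{θ,ω}` acts by `F ↦ ((θ + n) F (n + 1) + ω n F n)ₙ`, which is
monotone for `θ, ω ≥ 0`. Hence `φ(Δ_{θ,ω}) f` is dominated by the case `φ = exp (a z)`,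
`f = exp (b z)`, where the flow `exp (t Δ_{θ,ω})` has an explicit solution of exponential type
`outType t ω b` and bounds the exponential series by a comparison principle. These bounds give the
convergence of the series, the type of the sum and the joint continuity.

It remains to preserve `ℒ⁺`. Let `p` be a polynomial with roots in `(-∞, 0]` and `Δ_{θ,ω} p ≠ 0`.
At a point `s²` with `0 < re s`, `Δ_{θ,ω} p / p = (∑ u)² - ∑ u²` for some numbers `u` in the closed
right half-plane, and by Aczél's inequality this is never a nonpositive real. So
`p ↦ Δ_{θ,ω} p + x p` with `0 ≤ x` keeps the roots in `(-∞, 0]`, and hence so does `φ(Δ_{θ,ω})` for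
every polynomial `φ` of this kind. Laguerre entire functions are limits of such polynomials in
`𝒜_a`; conversely an entire limit of such polynomials is Laguerre, by compactness of their
expansions in linear factors at `z = 1`.
-/

noncomputable section

open Filter Polynomial Topology
open scoped ComplexOrder NNReal

section QuadraticForm

variable {ι : Type*} {s : Finset ι}

theorem sum_sq_lt_sq_sum {x : ι → ℝ} (hx : ∀ i ∈ s, 0 ≤ x i) {i j : ι} (hi : i ∈ s) (hj : j ∈ s)
    (hij : i ≠ j) (hxi : 0 < x i) (hxj : 0 < x j) : ∑ k ∈ s, x k ^ 2 < (∑ k ∈ s, x k) ^ 2 := by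
  simp only [sq, Finset.sum_mul]
  refine Finset.sum_lt_sum (fun k hk => ?_) ⟨i, hi, ?_⟩
  · exact mul_le_mul_of_nonneg_left (Finset.single_le_sum hx hk) (hx k hk)
  · exact mul_lt_mul_of_pos_left
      (Finset.single_lt_sum hij.symm hi hj hxj fun k hk _ => hx k hk) hxi

/-- Aczél's inequality for the Lorentzian form `(∑ x)² - ∑ x²`: the orthogonal complement of a
positive vector is negative. -/
theorem sq_sum_le_sum_sq_of_orthogonal {x y : ι → ℝ}
    (hx : ∑ k ∈ s, x k ^ 2 < (∑ k ∈ s, x k) ^ 2)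
    (hxy : ∑ k ∈ s, x k * y k = (∑ k ∈ s, x k) * ∑ k ∈ s, y k) :
    (∑ k ∈ s, y k) ^ 2 ≤ ∑ k ∈ s, y k ^ 2 := by
  have hcs := Finset.sum_mul_sq_le_sq_mul_sq s x y
  rw [hxy, mul_pow] at hcs
  have hy : 0 ≤ ∑ k ∈ s, y k ^ 2 := Finset.sum_nonneg fun k _ => sq_nonneg _
  have hpos : 0 < (∑ k ∈ s, x k) ^ 2 := (Finset.sum_nonneg fun k _ => sq_nonneg _).trans_lt hx
  exact le_of_mul_le_mul_left (hcs.trans (mul_le_mul_of_nonneg_right hx.le hy)) hpos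

theorem not_sq_sum_sub_sum_sq_nonpos {u : ι → ℂ}
    (hu : ∑ k ∈ s, (u k).re ^ 2 < (∑ k ∈ s, (u k).re) ^ 2) :
    ¬ (∑ k ∈ s, u k) ^ 2 - ∑ k ∈ s, u k ^ 2 ≤ 0 := by
  intro h
  obtain ⟨hre, him⟩ := Complex.le_def.1 h
  simp only [sq, Complex.sub_re, Complex.sub_im, Complex.re_sum, Complex.im_sum, Complex.mul_re,
    Complex.mul_im, Finset.sum_sub_distrib, Finset.sum_add_distrib, Complex.zero_re,
    Complex.zero_im] at hre him
  have hcomm : ∑ k ∈ s, (u k).im * (u k).re = ∑ k ∈ s, (u k).re * (u k).im :=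
    Finset.sum_congr rfl fun k _ => mul_comm _ _
  have hneg := sq_sum_le_sum_sq_of_orthogonal hu (y := fun k => (u k).im) (by linarith)
  simp only [sq] at hu hneg
  linarith

end QuadraticForm

theorem eval_derivative_prod_X_add_C {K ι : Type*} [Field K] {s : Finset ι} {r : ι → K} {z : K}
    (hz : ∀ i ∈ s, z + r i ≠ 0) :
    (derivative (∏ i ∈ s, (X + C (r i)))).eval z =
      (∏ i ∈ s, (z + r i)) * ∑ i ∈ s, (z + r i)⁻¹ := by
  classical
  simp only [derivative_prod_finset, eval_finsetSum, eval_prod, derivative_add, derivative_X,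
    derivative_C, eval_add, eval_X, eval_C, add_zero, mul_one, Finset.mul_sum]
  refine Finset.sum_congr rfl fun i hi => ?_
  rw [← Finset.mul_prod_erase s _ hi, mul_comm, inv_mul_cancel_left₀ (hz i hi)]

theorem eval_derivative_derivative_prod_X_add_C {K ι : Type*} [Field K] {s : Finset ι} {r : ι → K}
    {z : K} (hz : ∀ i ∈ s, z + r i ≠ 0) :
    (derivative (derivative (∏ i ∈ s, (X + C (r i))))).eval z =
      (∏ i ∈ s, (z + r i)) * ((∑ i ∈ s, (z + r i)⁻¹) ^ 2 - ∑ i ∈ s, (z + r i)⁻¹ ^ 2) := by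
  classical
  induction s using Finset.induction_on with
  | empty => simp
  | insert i s hi ih =>
    have hzs : ∀ j ∈ s, z + r j ≠ 0 := fun j hj => hz j (Finset.mem_insert_of_mem hj)
    have hzi : z + r i ≠ 0 := hz i (Finset.mem_insert_self i s)
    simp only [Finset.prod_insert hi, Finset.sum_insert hi, derivative_mul, derivative_add,
      derivative_X, derivative_C, add_zero, one_mul, eval_add, eval_mul, eval_X, eval_C,
      eval_derivative_prod_X_add_C hzs, ih hzs]
    field_simp
    ring

/-- All complex roots of `p` lie in `(-∞, 0]`. The zero polynomial is included. -/
def NonposRooted (p : ℂ[X]) : Prop := ∀ z ∈ p.roots, z ≤ 0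

namespace NonposRooted

variable {p q : ℂ[X]}

theorem zero : NonposRooted 0 := by simp [NonposRooted]

theorem one : NonposRooted 1 := by simp [NonposRooted]

theorem X : NonposRooted X := by simp [NonposRooted]

theorem smul (hp : NonposRooted p) (c : ℂ) : NonposRooted (c • p) := by
  rcases eq_or_ne c 0 with rfl | hc
  · simpa using zero
  · rwa [NonposRooted, roots_smul_nonzero _ hc]

theorem mul (hp : NonposRooted p) (hq : NonposRooted q) : NonposRooted (p * q) := by
  rcases eq_or_ne (p * q) 0 with h | h
  · simpa [h] using zero
  · intro z hz
    rw [roots_mul h, Multiset.mem_add] at hz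
    exact hz.elim (hp z) (hq z)

theorem prod {ι : Type*} {s : Finset ι} {p : ι → ℂ[X]} (hp : ∀ i ∈ s, NonposRooted (p i)) :
    NonposRooted (∏ i ∈ s, p i) :=
  Finset.prod_induction p NonposRooted (fun _ _ => mul) one hp

theorem pow (hp : NonposRooted p) (n : ℕ) : NonposRooted (p ^ n) := by
  simpa using prod (s := Finset.range n) fun _ _ => hp

theorem one_add_C_mul_X {β : ℝ} (hβ : 0 ≤ β) :
    NonposRooted (1 + C (β : ℂ) * Polynomial.X) := by
  intro z hz
  have hz0 : 1 + (β : ℂ) * z = 0 := by simpa using (mem_roots'.1 hz).2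
  have hβ0 : β ≠ 0 := fun h => by simp [h] at hz0
  have hz' : z = ((-β⁻¹ : ℝ) : ℂ) := by
    have : (β : ℂ) ≠ 0 := by exact_mod_cast hβ0
    push_cast
    field_simp
    linear_combination hz0
  rw [hz']
  exact_mod_cast neg_nonpos.2 (inv_nonneg.2 hβ)

theorem exists_monotone (hp : NonposRooted p) :
    ∃ (n : ℕ) (r : Fin n → ℝ), Monotone r ∧ (∀ i, 0 ≤ r i) ∧
      p = C p.leadingCoeff * ∏ i, (Polynomial.X + C (r i : ℂ)) := by
  set m : Multiset ℝ := p.roots.map fun z => -z.re with hm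
  have hroots : p.roots = m.map fun t : ℝ => -(t : ℂ) := by
    rw [hm, Multiset.map_map]
    refine (Multiset.map_id p.roots).symm.trans (Multiset.map_congr rfl fun z hz => ?_)
    exact Complex.ext (by simp) (by simpa using (Complex.le_def.1 (hp z hz)).2)
  set l := m.sort (· ≤ ·)
  refine ⟨l.length, l.get, (m.pairwise_sort (· ≤ ·)).sortedLE.monotone_get, fun i => ?_, ?_⟩
  · have hi : l.get i ∈ m := by rw [← Multiset.mem_sort (· ≤ ·)]; exact l.get_mem i
    obtain ⟨z, hz, hzi⟩ := Multiset.mem_map.1 hi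
    rw [← hzi]
    exact neg_nonneg.2 (Complex.le_def.1 (hp z hz)).1
  · have hml : m = (List.ofFn l.get : Multiset ℝ) := by rw [List.ofFn_get, Multiset.sort_eq]
    conv_lhs => rw [(IsAlgClosed.splits p).eq_prod_roots, hroots, hml]
    simp only [Multiset.map_coe, Multiset.prod_coe, List.map_ofFn, List.prod_ofFn,
      Function.comp_apply, map_neg, sub_neg_eq_add]

end NonposRooted

/-- The operator `Δ_{θ,ω}` on polynomials. -/
def polyDelta (θ ω : ℝ) : Module.End ℂ ℂ[X] :=
  (θ : ℂ) • derivative + LinearMap.mulLeft ℂ X ∘ₗ derivative ∘ₗ derivative +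
    (ω : ℂ) • (LinearMap.mulLeft ℂ X ∘ₗ derivative)

theorem eval_polyDelta (θ ω : ℝ) (p : ℂ[X]) (z : ℂ) :
    (polyDelta θ ω p).eval z = θ * (derivative p).eval z
      + z * (derivative (derivative p)).eval z + ω * z * (derivative p).eval z := by
  simp [polyDelta, mul_assoc]

/-- The numbers `u` for which `Δ_{θ,ω} p / p = (∑ u)² - ∑ u²` at the point `s²`, where
`p = ∏ i, (X + r i)`. For `0 < re s` and `0 ≤ r i` they lie in the closed right half-plane. -/
def deltaWeight {ι : Type*} (θ ω : ℝ) (r : ι → ℝ) (s : ℂ) : Option ι → ℂ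
  | none => (θ * s⁻¹ + ω * s) / 2
  | some i => s * (s ^ 2 + r i)⁻¹

section Roots

variable {θ ω : ℝ} {ι : Type*} {r : ι → ℝ} {s : ℂ}

theorem eval_polyDelta_prod [Fintype ι] (hs : s ≠ 0) (hr : ∀ i, s ^ 2 + (r i : ℂ) ≠ 0) :
    (polyDelta θ ω (∏ i, (X + C (r i : ℂ)))).eval (s ^ 2) =
      (∏ i, (s ^ 2 + (r i : ℂ))) *
        ((∑ o, deltaWeight θ ω r s o) ^ 2 - ∑ o, deltaWeight θ ω r s o ^ 2) := by
  rw [eval_polyDelta, eval_derivative_prod_X_add_C fun i _ => hr i,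
    eval_derivative_derivative_prod_X_add_C fun i _ => hr i]
  simp only [Fintype.sum_option, deltaWeight, ← Finset.mul_sum, mul_pow]
  field_simp
  ring

theorem re_inv_pos (hs : 0 < s.re) : 0 < (s⁻¹).re := by
  rw [Complex.inv_re]
  exact div_pos hs (Complex.normSq_pos.2 fun h => by simp [h] at hs)

theorem sq_add_ofReal_eq (hs : 0 < s.re) (t : ℝ) : s ^ 2 + t = s * (s + t * s⁻¹) := by
  have : s ≠ 0 := fun h => by simp [h] at hs
  field_simp

theorem re_add_ofReal_mul_inv_pos (hs : 0 < s.re) {t : ℝ} (ht : 0 ≤ t) :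
    0 < (s + t * s⁻¹).re := by
  rw [Complex.add_re, Complex.re_ofReal_mul]
  exact add_pos_of_pos_of_nonneg hs (mul_nonneg ht (re_inv_pos hs).le)

theorem sq_add_ofReal_ne_zero (hs : 0 < s.re) {t : ℝ} (ht : 0 ≤ t) : s ^ 2 + t ≠ 0 := by
  rw [sq_add_ofReal_eq hs]
  refine mul_ne_zero (fun h => by simp [h] at hs) fun h => ?_
  simpa [h] using re_add_ofReal_mul_inv_pos hs ht

theorem re_deltaWeight_some_pos (hs : 0 < s.re) {i : ι} (hr : 0 ≤ r i) :
    0 < (deltaWeight θ ω r s (some i)).re := by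
  have hs0 : s ≠ 0 := fun h => by simp [h] at hs
  rw [deltaWeight, sq_add_ofReal_eq hs, mul_inv, mul_inv_cancel_left₀ hs0]
  exact re_inv_pos (re_add_ofReal_mul_inv_pos hs hr)

theorem re_deltaWeight_none :
    (deltaWeight θ ω r s none).re = (θ * (s⁻¹).re + ω * s.re) / 2 := by
  simp [deltaWeight]

theorem re_deltaWeight_nonneg (hθ : 0 ≤ θ) (hω : 0 ≤ ω) (hs : 0 < s.re) (hr : ∀ i, 0 ≤ r i)
    (o : Option ι) : 0 ≤ (deltaWeight θ ω r s o).re := by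
  cases o with
  | none =>
    have := (re_inv_pos hs).le
    rw [re_deltaWeight_none]
    positivity
  | some i => exact (re_deltaWeight_some_pos hs (hr i)).le

theorem exists_ne_re_deltaWeight_pos [Fintype ι] (hθ : 0 ≤ θ) (hω : 0 ≤ ω) (hs : 0 < s.re)
    (hr : ∀ i, 0 ≤ r i) (hΔ : polyDelta θ ω (∏ i, (X + C (r i : ℂ))) ≠ 0) :
    ∃ o o' : Option ι, o ≠ o' ∧
      0 < (deltaWeight θ ω r s o).re ∧ 0 < (deltaWeight θ ω r s o').re := by
  have hsome (i : ι) : 0 < (deltaWeight θ ω r s (some i)).re := re_deltaWeight_some_pos hs (hr i)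
  rcases subsingleton_or_nontrivial ι with h | h
  · rcases isEmpty_or_nonempty ι with h | ⟨⟨i⟩⟩
    · simp [polyDelta] at hΔ
    · refine ⟨some i, none, Option.some_ne_none i, hsome i, ?_⟩
      have hinv := re_inv_pos hs
      have hθω : θ ≠ 0 ∨ ω ≠ 0 := by
        contrapose! hΔ
        let _ := uniqueOfSubsingleton i
        simp [polyDelta, hΔ]
      rw [re_deltaWeight_none]
      rcases hθω with h | h
      · have := hθ.lt_of_ne' h
        positivity
      · have := hω.lt_of_ne' h
        positivity
  · obtain ⟨i, j, hij⟩ := exists_pair_ne ι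
    exact ⟨some i, some j, by simpa using hij, hsome i, hsome j⟩

end Roots

theorem exists_re_pos_sq_eq {z : ℂ} (hz : ¬ z ≤ 0) : ∃ s : ℂ, 0 < s.re ∧ s ^ 2 = z := by
  obtain ⟨s, rfl⟩ := IsAlgClosed.exists_pow_nat_eq z two_pos
  have hs : s.re ≠ 0 := fun h => hz <| Complex.le_def.2 (by simp [sq, h, mul_self_nonneg])
  rcases hs.lt_or_gt with h | h
  · exact ⟨-s, by simpa using h, neg_sq s⟩
  · exact ⟨s, h, rfl⟩

namespace NonposRooted

variable {θ ω : ℝ} {p φ : ℂ[X]}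

theorem smul_add_polyDelta (hθ : 0 ≤ θ) (hω : 0 ≤ ω) {κ : ℝ} (hκ : 0 ≤ κ)
    (hp : NonposRooted p) : NonposRooted ((κ : ℂ) • p + polyDelta θ ω p) := by
  rcases eq_or_ne (polyDelta θ ω p) 0 with hΔ | hΔ
  · simpa [hΔ] using hp.smul (κ : ℂ)
  obtain ⟨n, r, -, hr, hpr⟩ := hp.exists_monotone
  intro z hz
  by_contra hz0
  obtain ⟨s, hs, rfl⟩ := exists_re_pos_sq_eq hz0
  have hsr (i : Fin n) : s ^ 2 + (r i : ℂ) ≠ 0 := sq_add_ofReal_ne_zero hs (hr i)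
  set P : ℂ[X] := ∏ i, (Polynomial.X + C (r i : ℂ))
  set u := deltaWeight θ ω r s
  rw [hpr, ← smul_eq_C_mul, map_smul] at hΔ
  obtain ⟨o, o', hne, ho, ho'⟩ :=
    exists_ne_re_deltaWeight_pos hθ hω hs hr (right_ne_zero_of_smul hΔ)
  refine not_sq_sum_sub_sum_sq_nonpos (sum_sq_lt_sq_sum
    (fun k _ => re_deltaWeight_nonneg hθ hω hs hr k) (Finset.mem_univ o) (Finset.mem_univ o')
    hne ho ho') ?_
  have hroot : p.leadingCoeff * (∏ i, (s ^ 2 + (r i : ℂ))) *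
      (κ + ((∑ o, u o) ^ 2 - ∑ o, u o ^ 2)) = 0 := by
    have h := (mem_roots'.1 hz).2
    rw [hpr, ← smul_eq_C_mul, map_smul, IsRoot.def, eval_add, eval_smul, eval_smul, eval_smul,
      eval_polyDelta_prod (fun h => by simp [h] at hs) hsr] at h
    simp only [P, eval_prod, eval_add, eval_X, eval_C, smul_eq_mul] at h
    linear_combination h
  have hne0 : p.leadingCoeff * (∏ i, (s ^ 2 + (r i : ℂ))) ≠ 0 :=
    mul_ne_zero (left_ne_zero_of_smul hΔ) (Finset.prod_ne_zero_iff.2 fun i _ => hsr i)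
  rw [eq_neg_of_add_eq_zero_right ((mul_eq_zero.1 hroot).resolve_left hne0)]
  exact_mod_cast neg_nonpos.2 hκ

theorem aeval_polyDelta (hθ : 0 ≤ θ) (hω : 0 ≤ ω) (hφ : NonposRooted φ) (hp : NonposRooted p) :
    NonposRooted (aeval (polyDelta θ ω) φ p) := by
  obtain ⟨n, r, -, hr, hφr⟩ := hφ.exists_monotone
  have hprod (s : Finset (Fin n)) :
      NonposRooted (aeval (polyDelta θ ω) (∏ i ∈ s, (Polynomial.X + C (r i : ℂ))) p) := by
    induction s using Finset.induction_on with
    | empty => simpa using hp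
    | insert i s hi ih =>
      rw [Finset.prod_insert hi, map_mul, Module.End.mul_apply]
      simpa [add_comm, Algebra.algebraMap_eq_smul_one] using ih.smul_add_polyDelta hθ hω (hr i)
  rw [hφr, ← smul_eq_C_mul, map_smul]
  exact (hprod Finset.univ).smul _

end NonposRooted

section CanonicalProduct

/-- The canonical product of genus one with zeros `-1 / β j`; in contrast to `∏ (1 + β j * w)` it
depends continuously on `β` under an `ℓ²` domination. -/
def canonicalProduct (β : ℕ → ℝ) (w : ℂ) : ℂ := ∏' j, (1 + β j * w) * Complex.exp (-(β j * w))

theorem norm_one_add_mul_exp_neg_sub_one_le (x : ℂ) :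
    ‖(1 + x) * Complex.exp (-x) - 1‖ ≤ ‖x‖ ^ 2 * Real.exp (2 * ‖x‖) := by
  have hfactor : (1 + x) * Complex.exp (-x) - 1 =
      -(Complex.exp (-x) * (Complex.exp x - ∑ k ∈ Finset.range 2, x ^ k / k.factorial)) := by
    rw [mul_sub, ← Complex.exp_add, neg_add_cancel, Complex.exp_zero]
    simp [Finset.sum_range_succ]
    ring
  have hexp : ‖Complex.exp (-x)‖ ≤ Real.exp ‖x‖ := by simpa using Complex.norm_exp_le_exp_norm (-x)
  calc ‖(1 + x) * Complex.exp (-x) - 1‖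
      ≤ Real.exp ‖x‖ * (‖x‖ ^ 2 * Real.exp ‖x‖) := by
        rw [hfactor, norm_neg, norm_mul]
        exact mul_le_mul hexp (Complex.norm_exp_sub_sum_le_norm_mul_exp x 2) (norm_nonneg _)
          (Real.exp_pos _).le
    _ = ‖x‖ ^ 2 * Real.exp (2 * ‖x‖) := by rw [two_mul, Real.exp_add]; ring

theorem tendsto_canonicalProduct {α : Type*} {l : Filter α} {β : α → ℕ → ℝ} {b bound : ℕ → ℝ}
    (hβ : ∀ j, Tendsto (β · j) l (𝓝 (b j))) (hbound : ∀ᶠ i in l, ∀ j, |β i j| ≤ bound j)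
    (hbound_bdd : BddAbove (Set.range bound)) (hsum : Summable fun j => bound j ^ 2) (w : ℂ) :
    Tendsto (fun i => canonicalProduct (β i) w) l (𝓝 (canonicalProduct b w)) := by
  obtain ⟨B, hB⟩ := hbound_bdd
  have hlim (j : ℕ) : Tendsto (fun i => (1 + β i j * w) * Complex.exp (-(β i j * w)) - 1) l
      (𝓝 ((1 + b j * w) * Complex.exp (-(b j * w)) - 1)) := by
    have hcont : Continuous fun x : ℝ => (1 + x * w) * Complex.exp (-(x * w)) - 1 := by fun_prop
    exact (hcont.tendsto _).comp (hβ j)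
  have hle : ∀ᶠ i in l, ∀ j, ‖(1 + β i j * w) * Complex.exp (-(β i j * w)) - 1‖ ≤
      bound j ^ 2 * (‖w‖ ^ 2 * Real.exp (2 * (B * ‖w‖))) := by
    filter_upwards [hbound] with i hi j
    have hnorm : ‖(β i j : ℂ) * w‖ = |β i j| * ‖w‖ := by simp
    have hBj : |β i j| ≤ B := (hi j).trans (hB ⟨j, rfl⟩)
    refine (norm_one_add_mul_exp_neg_sub_one_le _).trans ?_
    rw [hnorm, mul_pow, mul_assoc]
    gcongr
    exact hi j
  simpa only [canonicalProduct, add_sub_cancel] using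
    tendsto_tprod_one_add_of_dominated_convergence (hsum.mul_right _) hlim hle

variable {β : ℕ → ℝ}

theorem multipliable_one_add_ofReal_mul (hβ : Summable β) (w : ℂ) :
    Multipliable fun j => 1 + (β j : ℂ) * w :=
  multipliable_one_add_of_summable (by simpa using hβ.abs.mul_right ‖w‖)

theorem tprod_one_add_ofReal_mul (hβ : Summable β) (w : ℂ) :
    ∏' j, (1 + (β j : ℂ) * w) = Complex.exp ((∑' j, β j : ℝ) * w) * canonicalProduct β w := by
  have hexp : HasProd (fun j => Complex.exp (-(β j * w)))
      (Complex.exp (-((∑' j, β j : ℝ) * w))) := by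
    have : HasSum (fun j => (β j : ℂ)) ((∑' j, β j : ℝ) : ℂ) := by exact_mod_cast hβ.hasSum
    exact (this.mul_right w).neg.cexp
  rw [canonicalProduct, ((multipliable_one_add_ofReal_mul hβ w).hasProd.mul hexp).tprod_eq,
    mul_left_comm, ← Complex.exp_add, add_neg_cancel, Complex.exp_zero, mul_one]

theorem le_tsum_div_of_antitone (hanti : Antitone β) (h0 : ∀ j, 0 ≤ β j) (hβ : Summable β) (j : ℕ) :
    β j ≤ (∑' i, β i) / (j + 1) := by
  rw [le_div_iff₀ (by positivity)]
  calc β j * (j + 1) = ∑ _i ∈ Finset.range (j + 1), β j := by simp [mul_comm]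
    _ ≤ ∑ i ∈ Finset.range (j + 1), β i :=
      Finset.sum_le_sum fun i hi => hanti (Finset.mem_range_succ_iff.1 hi)
    _ ≤ ∑' i, β i := hβ.sum_le_tsum _ fun i _ => h0 i

end CanonicalProduct

section SequenceLimits

variable {β : ℕ → ℕ → ℝ} {S : ℝ}

theorem exists_subseq_tendsto_tsum (h0 : ∀ n j, 0 ≤ β n j) (hβ : ∀ n, Summable (β n))
    (hS : ∀ n, ∑' j, β n j ≤ S) :
    ∃ (ψ : ℕ → ℕ) (σ : ℝ) (b : ℕ → ℝ), StrictMono ψ ∧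
      Tendsto (fun n => ∑' j, β (ψ n) j) atTop (𝓝 σ) ∧
      ∀ j, Tendsto (fun n => β (ψ n) j) atTop (𝓝 (b j)) := by
  have hcpt : IsCompact (Set.Icc (0 : ℝ) S ×ˢ Set.univ.pi fun _ : ℕ => Set.Icc (0 : ℝ) S) :=
    isCompact_Icc.prod (isCompact_univ_pi fun _ => isCompact_Icc)
  obtain ⟨⟨σ, b⟩, -, ψ, hψ, hlim⟩ := hcpt.tendsto_subseq (x := fun n => (∑' j, β n j, β n))
    fun n => ⟨⟨tsum_nonneg (h0 n), hS n⟩,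
      fun j _ => ⟨h0 n j, ((hβ n).le_tsum j fun i _ => h0 n i).trans (hS n)⟩⟩
  obtain ⟨hσ, hb⟩ := (Prod.tendsto_iff _ _).1 hlim
  exact ⟨ψ, σ, b, hψ, hσ, tendsto_pi_nhds.1 hb⟩

variable {σ : ℝ} {b : ℕ → ℝ}

theorem sum_le_of_tendsto_tsum (h0 : ∀ n j, 0 ≤ β n j) (hβ : ∀ n, Summable (β n))
    (hσ : Tendsto (fun n => ∑' j, β n j) atTop (𝓝 σ))
    (hb : ∀ j, Tendsto (fun n => β n j) atTop (𝓝 (b j))) (s : Finset ℕ) : ∑ j ∈ s, b j ≤ σ :=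
  le_of_tendsto_of_tendsto' (tendsto_finsetSum s fun j _ => hb j) hσ fun n =>
    (hβ n).sum_le_tsum s fun j _ => h0 n j

theorem tendsto_tprod_one_add_ofReal_mul (hanti : ∀ n, Antitone (β n)) (h0 : ∀ n j, 0 ≤ β n j)
    (hβ : ∀ n, Summable (β n)) (hS : ∀ n, ∑' j, β n j ≤ S)
    (hσ : Tendsto (fun n => ∑' j, β n j) atTop (𝓝 σ))
    (hb : ∀ j, Tendsto (fun n => β n j) atTop (𝓝 (b j))) (hbs : Summable b) (w : ℂ) :
    Tendsto (fun n => ∏' j, (1 + (β n j : ℂ) * w)) atTop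
      (𝓝 (Complex.exp ((σ - ∑' j, b j : ℝ) * w) * ∏' j, (1 + (b j : ℂ) * w))) := by
  have hbound (n j : ℕ) : |β n j| ≤ S / (j + 1) := by
    rw [abs_of_nonneg (h0 n j)]
    exact (le_tsum_div_of_antitone (hanti n) (h0 n) (hβ n) j).trans (by gcongr; exact hS n)
  have hS0 : 0 ≤ S := (tsum_nonneg (h0 0)).trans (hS 0)
  have hbdd : BddAbove (Set.range fun j : ℕ => S / ((j : ℝ) + 1)) := by
    refine ⟨S, ?_⟩
    rintro _ ⟨j, rfl⟩
    exact div_le_self hS0 (by simp)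
  have hsq : Summable fun j : ℕ => (S / ((j : ℝ) + 1)) ^ 2 := by
    have h : Summable fun j : ℕ => 1 / ((j : ℝ) + 1) ^ 2 := mod_cast
      (summable_nat_add_iff 1).2 (Real.summable_one_div_nat_pow.2 one_lt_two)
    simpa only [div_pow, mul_one_div] using h.mul_left (S ^ 2)
  have hexp : Tendsto (fun n => Complex.exp ((∑' j, β n j : ℝ) * w)) atTop
      (𝓝 (Complex.exp (σ * w))) := by
    have hcont : Continuous fun x : ℝ => Complex.exp (x * w) := by fun_prop
    exact (hcont.tendsto _).comp hσ
  have hlimit : Complex.exp ((σ - ∑' j, b j : ℝ) * w) * ∏' j, (1 + (b j : ℂ) * w) =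
      Complex.exp (σ * w) * canonicalProduct b w := by
    rw [tprod_one_add_ofReal_mul hbs, ← mul_assoc, ← Complex.exp_add, ← add_mul,
      ← Complex.ofReal_add, sub_add_cancel]
  rw [hlimit]
  simp only [tprod_one_add_ofReal_mul (hβ _)]
  exact hexp.mul (tendsto_canonicalProduct hb (.of_forall hbound) hbdd hsq w)

end SequenceLimits

section ExpansionAtOne

variable {b : ℕ → ℝ}

theorem summable_div_one_sub (hb : Antitone b) (h0 : ∀ j, 0 ≤ b j) (h1 : b 0 < 1)
    (hbs : Summable b) : Summable fun j => b j / (1 - b j) := by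
  have hle (j : ℕ) : b j ≤ b 0 := hb (Nat.zero_le j)
  refine Summable.of_nonneg_of_le (fun j => ?_) (fun j => ?_) (hbs.div_const (1 - b 0))
  · exact div_nonneg (h0 j) (by linarith [hle j])
  · exact div_le_div_of_nonneg_left (h0 j) (by linarith) (by linarith [hle j])

theorem tprod_one_add_mul_sub_one (hb : Antitone b) (h0 : ∀ j, 0 ≤ b j) (h1 : b 0 < 1)
    (hbs : Summable b) (z : ℂ) :
    ∏' j, (1 + (b j : ℂ) * (z - 1)) =
      (∏' j, (1 + ((-b j : ℝ) : ℂ) * 1)) * ∏' j, (1 + ((b j / (1 - b j) : ℝ) : ℂ) * z) := by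
  rw [← (multipliable_one_add_ofReal_mul hbs.neg 1).tprod_mul
    (multipliable_one_add_ofReal_mul (summable_div_one_sub hb h0 h1 hbs) z)]
  refine tprod_congr fun j => ?_
  have : 1 - (b j : ℂ) ≠ 0 := by exact_mod_cast (sub_pos.2 ((hb (Nat.zero_le j)).trans_lt h1)).ne'
  push_cast
  field_simp
  ring

theorem exists_forall_lt_eq_one (h1 : ∀ j, b j ≤ 1) (hbs : Summable b) :
    ∃ m, b m < 1 ∧ ∀ j < m, b j = 1 := by
  classical
  have hex : ∃ m, b m < 1 := (hbs.tendsto_atTop_zero.eventually_lt_const one_pos).exists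
  exact ⟨Nat.find hex, Nat.find_spec hex, fun j hj =>
    (h1 j).antisymm (not_lt.1 (Nat.find_min hex hj))⟩

/-- The factors with `b j = 1` make up the power of `z`. -/
theorem IsLaguerreEntire.of_expansion_at_one {g : ℂ → ℂ} {α : ℝ} (hα : 0 ≤ α) (hb : Antitone b)
    (h0 : ∀ j, 0 ≤ b j) (h1 : ∀ j, b j ≤ 1) (hbs : Summable b) (K : ℂ)
    (hg : ∀ z, g z = K * Complex.exp (α * (z - 1)) * ∏' j, (1 + (b j : ℂ) * (z - 1))) :
    IsLaguerreEntire g := by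
  obtain ⟨m, hm, hlt⟩ := exists_forall_lt_eq_one h1 hbs
  set c : ℕ → ℝ := fun j => b (j + m)
  have hc : Antitone c := fun i j hij => hb (Nat.add_le_add_right hij m)
  have hc0 (j : ℕ) : 0 ≤ c j := h0 _
  have hc1 : c 0 < 1 := by simpa [c] using hm
  have hcs : Summable c := (summable_nat_add_iff m).2 hbs
  have hsub (j : ℕ) : 0 < 1 - c j := sub_pos.2 ((hc (Nat.zero_le j)).trans_lt hc1)
  refine ⟨K * Complex.exp (-α) * ∏' j, (1 + ((-c j : ℝ) : ℂ) * 1), m, α, fun j => c j / (1 - c j),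
    hα, fun i j hij => ?_, fun j => div_nonneg (hc0 j) (hsub j).le,
    summable_div_one_sub hc hc0 hc1 hcs, fun z => ?_⟩
  · have := hc hij
    exact div_le_div₀ (hc0 i) this (hsub i) (by linarith)
  · have hhead : ∏ j ∈ Finset.range m, (1 + (b j : ℂ) * (z - 1)) = z ^ m := by
      rw [Finset.prod_congr rfl fun j hj => by rw [hlt j (Finset.mem_range.1 hj)]]
      simp
    have hsplit : ∏' j, (1 + (b j : ℂ) * (z - 1)) = z ^ m * ∏' j, (1 + (c j : ℂ) * (z - 1)) := by
      rw [← hhead]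
      exact (Multipliable.prod_mul_tprod_nat_mul' (f := fun j => 1 + (b j : ℂ) * (z - 1))
        (multipliable_one_add_ofReal_mul hcs (z - 1))).symm
    have hexp : Complex.exp (α * (z - 1)) = Complex.exp (-α) * Complex.exp (α * z) := by
      rw [← Complex.exp_add]
      ring_nf
    rw [hg, hsplit, hexp, tprod_one_add_mul_sub_one hc hc0 hc1 hcs]
    ac_rfl

end ExpansionAtOne

theorem one_add_sum_le_prod_one_add {ι R : Type*} [CommSemiring R] [PartialOrder R]
    [IsOrderedRing R] {s : Finset ι} {x : ι → R} (hx : ∀ i ∈ s, 0 ≤ x i) :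
    1 + ∑ i ∈ s, x i ≤ ∏ i ∈ s, (1 + x i) := by
  classical
  induction s using Finset.induction_on with
  | empty => simp
  | insert i s hi ih =>
    have hxs : ∀ j ∈ s, 0 ≤ x j := fun j hj => hx j (Finset.mem_insert_of_mem hj)
    have hxi : 0 ≤ x i := hx i (Finset.mem_insert_self i s)
    rw [Finset.sum_insert hi, Finset.prod_insert hi]
    calc 1 + (x i + ∑ j ∈ s, x j)
        ≤ 1 + (x i + ∑ j ∈ s, x j) + x i * ∑ j ∈ s, x j :=
          le_add_of_nonneg_right (mul_nonneg hxi (Finset.sum_nonneg hxs))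
      _ = (1 + x i) * (1 + ∑ j ∈ s, x j) := by ring
      _ ≤ (1 + x i) * ∏ j ∈ s, (1 + x j) :=
          mul_le_mul_of_nonneg_left (ih hxs) (add_nonneg zero_le_one hxi)

namespace NonposRooted

variable {p : ℂ[X]}

theorem exists_expansion_at_one (hp : NonposRooted p) :
    ∃ β : ℕ → ℝ, Antitone β ∧ (∀ j, 0 ≤ β j) ∧ (∀ j, β j ≤ 1) ∧ Summable β ∧
      ∀ z, p.eval z = p.eval 1 * ∏' j, (1 + (β j : ℂ) * (z - 1)) := by
  obtain ⟨n, r, hmono, hr, hpr⟩ := hp.exists_monotone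
  set β : ℕ → ℝ := fun j => if h : j < n then (1 + r ⟨j, h⟩)⁻¹ else 0 with hβ
  have hlt (i : Fin n) : β i = (1 + r i)⁻¹ := by simp [hβ]
  have hge (j : ℕ) (hj : n ≤ j) : β j = 0 := by simp [hβ, hj.not_gt]
  have hpos (i : Fin n) : 0 < 1 + r i := by linarith [hr i]
  refine ⟨β, fun i j hij => ?_, fun j => ?_, fun j => ?_,
    summable_of_ne_finset_zero (s := Finset.range n) fun j hj => hge j (by simpa using hj),
    fun z => ?_⟩
  · rcases lt_or_ge j n with hj | hj
    · rw [hlt ⟨i, hij.trans_lt hj⟩, hlt ⟨j, hj⟩]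
      exact inv_anti₀ (hpos _) (by gcongr; exact hmono hij)
    · rw [hge j hj, hβ]
      dsimp only
      split_ifs
      exacts [inv_nonneg.2 (hpos _).le, le_rfl]
  · rcases lt_or_ge j n with hj | hj
    · exact (hlt ⟨j, hj⟩).symm ▸ inv_nonneg.2 (hpos _).le
    · exact (hge j hj).ge
  · rcases lt_or_ge j n with hj | hj
    · exact (hlt ⟨j, hj⟩).symm ▸ inv_le_one_of_one_le₀ (by linarith [hr ⟨j, hj⟩])
    · exact (hge j hj).trans_le zero_le_one
  · have heval (w : ℂ) : p.eval w = p.leadingCoeff * ∏ i, (w + r i) := by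
      conv_lhs => rw [hpr]
      simp [eval_prod]
    rw [tprod_eq_prod (s := Finset.range n) fun j hj => by simp [hge j (by simpa using hj)],
      Finset.prod_range, heval, heval 1, mul_assoc, ← Finset.prod_mul_distrib]
    congr 1
    refine Finset.prod_congr rfl fun i _ => ?_
    have : 1 + (r i : ℂ) ≠ 0 := by exact_mod_cast (hpos i).ne'
    rw [hlt]
    push_cast
    field_simp
    ring

theorem norm_eval_le_norm_eval_one (hp : NonposRooted p) {z : ℂ} (hz : ‖z‖ ≤ 1) :
    ‖p.eval z‖ ≤ ‖p.eval 1‖ := by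
  obtain ⟨n, r, -, hr, hpr⟩ := hp.exists_monotone
  rw [hpr]
  simp only [eval_mul, eval_C, eval_prod, eval_add, eval_X, norm_mul, norm_prod]
  gcongr with i
  calc ‖z + r i‖ ≤ ‖z‖ + ‖(r i : ℂ)‖ := norm_add_le _ _
    _ ≤ 1 + r i := by
      rw [Complex.norm_of_nonneg (hr i)]
      gcongr
    _ = ‖1 + (r i : ℂ)‖ := by
      rw [← Complex.ofReal_one, ← Complex.ofReal_add,
        Complex.norm_of_nonneg (by linarith [hr i])]

end NonposRooted

theorem tsum_le_norm_tprod_one_add {β : ℕ → ℝ} (h0 : ∀ j, 0 ≤ β j) (hβ : Summable β) :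
    ∑' j, β j ≤ ‖∏' j, (1 + (β j : ℂ))‖ := by
  have hprod : HasProd (fun j => 1 + (β j : ℂ)) (∏' j, (1 + (β j : ℂ))) := by
    simpa using (multipliable_one_add_ofReal_mul hβ 1).hasProd
  refine le_of_tendsto_of_tendsto' hβ.hasSum.tendsto_sum_nat hprod.tendsto_prod_nat.norm fun n => ?_
  have hnorm (j : ℕ) : ‖1 + (β j : ℂ)‖ = 1 + β j := by
    rw [← Complex.ofReal_one, ← Complex.ofReal_add, Complex.norm_of_nonneg (by linarith [h0 j])]
  simp only [norm_prod, hnorm]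
  linarith [one_add_sum_le_prod_one_add (s := Finset.range n) fun j _ => h0 j]

namespace IsLaguerreEntire

variable {p : ℕ → ℂ[X]} {g : ℂ → ℂ}

theorem zero : IsLaguerreEntire 0 :=
  ⟨0, 0, 0, 0, le_rfl, antitone_const, fun _ => le_rfl, summable_zero, fun z => by simp⟩

theorem of_tendsto_of_ne_zero (hp : ∀ n, NonposRooted (p n))
    (hlim : ∀ z, Tendsto (fun n => (p n).eval z) atTop (𝓝 (g z))) (hg1 : g 1 ≠ 0) :
    IsLaguerreEntire g := by
  choose β hanti h0 h1 hsum heval using fun n => (hp n).exists_expansion_at_one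
  have hbdd : ∀ᶠ n in atTop, ∑' j, β n j ≤ ‖g 2 / g 1‖ + 1 := by
    filter_upwards [((hlim 2).div (hlim 1) hg1).norm.eventually_lt_const (lt_add_one _),
      (hlim 1).eventually_ne hg1] with n hn hn1
    rw [Pi.div_apply, heval n 2, mul_div_cancel_left₀ _ hn1] at hn
    simp only [show (2 : ℂ) - 1 = 1 by norm_num, mul_one] at hn
    exact (tsum_le_norm_tprod_one_add (h0 n) (hsum n)).trans hn.le
  obtain ⟨N, hN⟩ := eventually_atTop.1 hbdd
  obtain ⟨ψ, σ, b, hψ, hσ, hb⟩ := exists_subseq_tendsto_tsum (β := fun n => β (n + N))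
    (fun n => h0 _) (fun n => hsum _) fun n => hN _ (Nat.le_add_left N n)
  have hb0 (j : ℕ) : 0 ≤ b j := ge_of_tendsto' (hb j) fun n => h0 _ j
  have hb1 (j : ℕ) : b j ≤ 1 := le_of_tendsto' (hb j) fun n => h1 _ j
  have hbanti : Antitone b := fun i j hij =>
    le_of_tendsto_of_tendsto' (hb j) (hb i) fun n => hanti _ hij
  have hbσ := sum_le_of_tendsto_tsum (fun n => h0 (ψ n + N)) (fun n => hsum _) hσ hb
  have hbs : Summable b := summable_of_sum_le hb0 hbσ
  refine of_expansion_at_one (sub_nonneg.2 (hbs.tsum_le_of_sum_le hbσ)) hbanti hb0 hb1 hbs (g 1)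
    fun z => ?_
  have hχ : Tendsto (fun n => ψ n + N) atTop atTop :=
    tendsto_atTop_mono (fun n => Nat.le_add_right _ _) hψ.tendsto_atTop
  have hprod := tendsto_tprod_one_add_ofReal_mul (fun n => hanti (ψ n + N)) (fun n => h0 _)
    (fun n => hsum _) (fun n => hN _ (Nat.le_add_left N _)) hσ hb hbs (z - 1)
  have hz := ((hlim 1).comp hχ).mul hprod
  simp only [Function.comp_apply, ← heval] at hz
  rw [mul_assoc]
  exact tendsto_nhds_unique ((hlim z).comp hχ) hz

theorem of_tendsto (hp : ∀ n, NonposRooted (p n)) (hg : Differentiable ℂ g)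
    (hlim : ∀ z, Tendsto (fun n => (p n).eval z) atTop (𝓝 (g z))) : IsLaguerreEntire g := by
  rcases eq_or_ne (g 1) 0 with hg1 | hg1
  · have hdisc (z : ℂ) (hz : ‖z‖ ≤ 1) : g z = 0 := by
      have h := le_of_tendsto_of_tendsto' (hlim z).norm (hlim 1).norm fun n =>
        (hp n).norm_eval_le_norm_eval_one hz
      simpa [hg1] using h
    have hzero : g = 0 :=
      (Complex.analyticOnNhd_univ_iff_differentiable.2 hg).eq_of_eventuallyEq
        analyticOnNhd_const <| by
          filter_upwards [Metric.ball_mem_nhds (0 : ℂ) one_pos] with z hz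
          exact hdisc z (mem_ball_zero_iff.1 hz).le
    exact hzero ▸ zero
  · exact of_tendsto_of_ne_zero hp hlim hg1

end IsLaguerreEntire

/-- The sequence of derivatives `f^{(n)}(0)`. -/
def derivSeq (f : ℂ → ℂ) (n : ℕ) : ℂ := iteratedDeriv n f 0

section PowerSeries

variable {f : ℂ → ℂ}

theorem hasSum_derivSeq (hf : Differentiable ℂ f) (z : ℂ) :
    HasSum (fun n => derivSeq f n * (z ^ n / n.factorial)) (f z) := by
  refine (Complex.hasSum_taylorSeries_of_entire hf 0 z).congr_fun fun n => ?_
  simp only [derivSeq, sub_zero, smul_eq_mul]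
  ring

theorem hasFPowerSeriesOnBall_of_hasSum {c : ℕ → ℂ}
    (h : ∀ z, HasSum (fun n => c n * z ^ n) (f z)) :
    HasFPowerSeriesOnBall f (FormalMultilinearSeries.ofScalars ℂ c) 0 ⊤ := by
  refine ⟨?_, ENNReal.zero_lt_top, fun {y} _ => ?_⟩
  · rw [FormalMultilinearSeries.radius_eq_top_of_summable_norm]
    intro r
    refine (h (r : ℝ)).summable.norm.congr fun n => ?_
    simp
  · rw [zero_add]
    refine (h y).congr_fun fun n => ?_
    simp [mul_comm]

theorem differentiable_of_hasSum {c : ℕ → ℂ} (h : ∀ z, HasSum (fun n => c n * z ^ n) (f z)) :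
    Differentiable ℂ f := by
  rw [← differentiableOn_univ, ← Metric.eball_top 0]
  exact (hasFPowerSeriesOnBall_of_hasSum h).differentiableOn

theorem derivSeq_of_hasSum {c : ℕ → ℂ} (h : ∀ z, HasSum (fun n => c n * z ^ n) (f z)) (n : ℕ) :
    derivSeq f n = n.factorial * c n := by
  rw [derivSeq, iteratedDeriv_eq_iteratedFDeriv,
    ← (hasFPowerSeriesOnBall_of_hasSum h).factorial_smul 1 n,
    FormalMultilinearSeries.ofScalars_apply_eq]
  simp

theorem hasSum_coeff_mul_pow {R : Type*} [Semiring R] [TopologicalSpace R] (p : R[X]) (x : R) :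
    HasSum (fun n => p.coeff n * x ^ n) (p.eval x) := by
  simp only [eval_eq_sum, sum_def]
  exact hasSum_sum_of_ne_finset_zero fun n hn => by simp [notMem_support_iff.1 hn]

theorem derivSeq_eval (p : ℂ[X]) (n : ℕ) :
    derivSeq (fun z => p.eval z) n = n.factorial * p.coeff n :=
  derivSeq_of_hasSum (hasSum_coeff_mul_pow p) n

theorem iteratedDeriv_id_mul_zero (hf : Differentiable ℂ f) (n : ℕ) :
    iteratedDeriv n (fun z => z * f z) 0 = n * iteratedDeriv (n - 1) f 0 := by
  rw [iteratedDeriv_fun_mul (f := fun z => z) contDiffAt_id hf.contDiff.contDiffAt]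
  simp only [iteratedDeriv_fun_id_zero]
  rw [Finset.sum_eq_single 1 (fun i _ hi => by simp [hi])]
  · simp
  · intro h
    simp [show n = 0 by simpa using h]

end PowerSeries

section SeqDelta

variable {R : Type*} [CommSemiring R]

/-- The action of `Δ_{θ,ω}` on sequences of derivatives at `0`. -/
def seqDelta (θ ω : R) : Module.End R (ℕ → R) where
  toFun F n := (θ + n) * F (n + 1) + ω * n * F n
  map_add' F G := by
    ext n
    simp only [Pi.add_apply]
    ring
  map_smul' c F := by
    ext n
    simp only [Pi.smul_apply, smul_eq_mul, RingHom.id_apply]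
    ring

theorem seqDelta_apply (θ ω : R) (F : ℕ → R) (n : ℕ) :
    seqDelta θ ω F n = (θ + n) * F (n + 1) + ω * n * F n := rfl

theorem seqDelta_pow_mono [PartialOrder R] [IsOrderedRing R] {θ ω : R} (hθ : 0 ≤ θ) (hω : 0 ≤ ω)
    (k : ℕ) : Monotone (seqDelta θ ω ^ k) := by
  rw [Module.End.coe_pow]
  refine Monotone.iterate (fun F G h n => ?_) k
  exact add_le_add (mul_le_mul_of_nonneg_left (h (n + 1)) (by positivity))
    (mul_le_mul_of_nonneg_left (h n) (by positivity))

theorem norm_seqDelta_pow_le {𝕜 : Type*} [NormedField 𝕜] (θ ω : 𝕜) (k : ℕ) (F : ℕ → 𝕜) (n : ℕ) :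
    ‖(seqDelta θ ω ^ k) F n‖ ≤ (seqDelta ‖θ‖ ‖ω‖ ^ k) (fun m => ‖F m‖) n := by
  induction k generalizing F with
  | zero => exact le_rfl
  | succ k ih =>
    rw [pow_succ, pow_succ]
    refine (ih _).trans (seqDelta_pow_mono (norm_nonneg θ) (norm_nonneg ω) k (fun m => ?_) n)
    have hm : ‖(m : 𝕜)‖ ≤ m := by simpa using Nat.norm_cast_le (α := 𝕜) m
    calc ‖(θ + m) * F (m + 1) + ω * m * F m‖
        ≤ ‖θ + m‖ * ‖F (m + 1)‖ + ‖ω‖ * ‖(m : 𝕜)‖ * ‖F m‖ := by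
          simpa only [norm_mul] using norm_add_le ((θ + m) * F (m + 1)) (ω * m * F m)
      _ ≤ (‖θ‖ + m) * ‖F (m + 1)‖ + ‖ω‖ * m * ‖F m‖ := by
          gcongr
          exact (norm_add_le _ _).trans (by gcongr)

end SeqDelta

section LagDelta

variable {f : ℂ → ℂ}

theorem differentiable_lagDelta (hf : Differentiable ℂ f) (θ ω : ℝ) :
    Differentiable ℂ (lagDelta θ ω f) := by
  have : Differentiable ℂ (deriv f) := hf.deriv
  have : Differentiable ℂ (deriv (deriv f)) := hf.deriv.deriv
  unfold lagDelta
  fun_prop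

theorem derivSeq_lagDelta (hf : Differentiable ℂ f) (θ ω : ℝ) :
    derivSeq (lagDelta θ ω f) = seqDelta (θ : ℂ) ω (derivSeq f) := by
  funext n
  have hf' : Differentiable ℂ (deriv f) := hf.deriv
  have hf'' : Differentiable ℂ (deriv (deriv f)) := hf'.deriv
  have hsum : lagDelta θ ω f = ((θ : ℂ) • deriv f + fun z => z * deriv (deriv f) z) +
      (ω : ℂ) • fun z => z * deriv f z := by
    funext z
    simp [lagDelta, mul_assoc]
  have hzf' : Differentiable ℂ fun z => z * deriv f z := by fun_prop
  have hzf'' : Differentiable ℂ fun z => z * deriv (deriv f) z := by fun_prop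
  rw [seqDelta_apply, hsum, derivSeq,
    iteratedDeriv_add_of_entire ((hf'.const_smul _).add hzf'') (hzf'.const_smul _),
    iteratedDeriv_add_of_entire (hf'.const_smul _) hzf'', iteratedDeriv_smul_at_zero,
    iteratedDeriv_smul_at_zero, iteratedDeriv_id_mul_zero hf'', iteratedDeriv_id_mul_zero hf',
    ← iteratedDeriv_succ']
  rcases n with _ | n
  · simp [derivSeq]
  · simp only [Nat.add_sub_cancel, ← iteratedDeriv_succ', derivSeq]
    ring

theorem differentiable_lagDelta_iterate (hf : Differentiable ℂ f) (θ ω : ℝ) (k : ℕ) :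
    Differentiable ℂ ((lagDelta θ ω)^[k] f) := by
  induction k with
  | zero => exact hf
  | succ k ih =>
    rw [Function.iterate_succ_apply']
    exact differentiable_lagDelta ih θ ω

theorem derivSeq_lagDelta_iterate (hf : Differentiable ℂ f) (θ ω : ℝ) (k : ℕ) :
    derivSeq ((lagDelta θ ω)^[k] f) = (seqDelta (θ : ℂ) ω ^ k) (derivSeq f) := by
  induction k with
  | zero => rfl
  | succ k ih =>
    rw [Function.iterate_succ_apply',
      derivSeq_lagDelta (differentiable_lagDelta_iterate hf θ ω k), ih, pow_succ',
      Module.End.mul_apply]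

theorem lagDelta_eval (θ ω : ℝ) (p : ℂ[X]) :
    lagDelta θ ω (fun z => p.eval z) = fun z => (polyDelta θ ω p).eval z := by
  funext z
  have hderiv : ∀ q : ℂ[X], deriv (fun z => q.eval z) = fun z => (derivative q).eval z :=
    fun q => funext fun z => q.deriv
  simp only [lagDelta, hderiv, eval_polyDelta]

theorem lagDelta_iterate_eval (θ ω : ℝ) (p : ℂ[X]) (k : ℕ) :
    (lagDelta θ ω)^[k] (fun z => p.eval z) = fun z => ((polyDelta θ ω ^ k) p).eval z := by
  induction k with
  | zero => rfl
  | succ k ih =>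
    rw [Function.iterate_succ_apply', ih, lagDelta_eval, pow_succ', Module.End.mul_apply]

theorem hasSum_opTerm_eval (θ ω : ℝ) (φ p : ℂ[X]) (z : ℂ) :
    HasSum (opTerm θ ω (fun z => φ.eval z) (fun z => p.eval z) z)
      ((aeval (polyDelta θ ω) φ p).eval z) := by
  have hterm : ∀ k, opTerm θ ω (fun z => φ.eval z) (fun z => p.eval z) z k =
      φ.coeff k * ((polyDelta θ ω ^ k) p).eval z := by
    intro k
    have : (k.factorial : ℂ) ≠ 0 := Nat.cast_ne_zero.2 k.factorial_ne_zero
    rw [opTerm, lagDelta_iterate_eval, ← derivSeq, derivSeq_eval, mul_div_cancel_left₀ _ this]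
  rw [aeval_def, eval₂_eq_sum, sum_def, LinearMap.sum_apply, eval_finsetSum]
  simp only [← Algebra.smul_def, LinearMap.smul_apply, eval_smul, smul_eq_mul, ← hterm]
  exact hasSum_sum_of_ne_finset_zero fun k hk => by simp [hterm, notMem_support_iff.1 hk]

end LagDelta

section Flow

variable {θ ω a b t : ℝ}

theorem hasDerivAt_expQuot (ω t : ℝ) : HasDerivAt (fun t => expQuot t ω) (Real.exp (t * ω)) t := by
  by_cases hω : ω = 0
  · simpa [expQuot, hω] using hasDerivAt_id' t
  · simp only [expQuot, hω, if_false]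
    refine (((hasDerivAt_mul_const ω).exp.sub_const 1).const_mul ω⁻¹).congr_deriv ?_
    field_simp

theorem expQuot_mono (ω : ℝ) : Monotone fun t => expQuot t ω :=
  monotone_of_deriv_nonneg (fun t => (hasDerivAt_expQuot ω t).differentiableAt) fun t => by
    rw [(hasDerivAt_expQuot ω t).deriv]
    positivity

theorem outType_nonneg (hb : 0 ≤ b) (hab : b * expQuot a ω < 1) : 0 ≤ outType a ω b := by
  have : 0 < 1 - b * expQuot a ω := sub_pos.2 hab
  unfold outType
  positivity

theorem hasDerivAt_outType (ht : b * expQuot t ω < 1) :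
    HasDerivAt (fun t => outType t ω b) (outType t ω b ^ 2 + ω * outType t ω b) t := by
  have hne : 1 - b * expQuot t ω ≠ 0 := (sub_pos.2 ht).ne'
  have hexp : HasDerivAt (fun t : ℝ => b * Real.exp (t * ω)) (b * (Real.exp (t * ω) * ω)) t :=
    (hasDerivAt_mul_const ω).exp.const_mul b
  have hinv := (((hasDerivAt_expQuot ω t).const_mul b).const_sub 1).fun_inv hne
  refine (hexp.fun_mul hinv).congr_deriv ?_
  simp only [outType]
  field_simp
  ring

/-- The derivatives at `0` of `exp (t Δ_{θ,ω})` applied to `z ↦ exp (b z)`; this function is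
`z ↦ (1 - b ω⁻¹ (e^{tω} - 1))^{-θ} exp (c z)`, where `c = outType t ω b`. -/
def flowCoeff (θ ω b t : ℝ) (n : ℕ) : ℝ :=
  (1 - b * expQuot t ω) ^ (-θ) * outType t ω b ^ n

theorem flowCoeff_zero (θ ω b : ℝ) (n : ℕ) : flowCoeff θ ω b 0 n = b ^ n := by
  simp [flowCoeff, outType, expQuot]

theorem flowCoeff_nonneg (hb : 0 ≤ b) (ht : b * expQuot t ω < 1) (n : ℕ) :
    0 ≤ flowCoeff θ ω b t n :=
  mul_nonneg (Real.rpow_nonneg (sub_pos.2 ht).le _) (pow_nonneg (outType_nonneg hb ht) n)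

theorem hasDerivAt_flowCoeff (θ : ℝ) (ht : b * expQuot t ω < 1) (n : ℕ) :
    HasDerivAt (fun t => flowCoeff θ ω b t n) (seqDelta θ ω (flowCoeff θ ω b t) n) t := by
  have hpos : 0 < 1 - b * expQuot t ω := sub_pos.2 ht
  have hrpow : HasDerivAt (fun t => (1 - b * expQuot t ω) ^ (-θ))
      (θ * outType t ω b * (1 - b * expQuot t ω) ^ (-θ)) t := by
    refine ((((hasDerivAt_expQuot ω t).const_mul b).const_sub 1).rpow_const
      (p := -θ) (Or.inl hpos.ne')).congr_deriv ?_
    rw [Real.rpow_sub_one hpos.ne', outType]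
    field_simp
  refine (hrpow.fun_mul ((hasDerivAt_outType ht).fun_pow n)).congr_deriv ?_
  simp only [seqDelta_apply, flowCoeff]
  rcases n with _ | n
  · simp
    ring
  · simp only [Nat.add_sub_cancel, pow_succ]
    push_cast
    ring

theorem hasDerivAt_sum_pow_div_factorial (x : ℕ → ℝ) (N : ℕ) (t : ℝ) :
    HasDerivAt (fun t => ∑ k ∈ Finset.range (N + 1), t ^ k / k.factorial * x k)
      (∑ k ∈ Finset.range N, t ^ k / k.factorial * x (k + 1)) t := by
  simp only [Finset.sum_range_succ' _ N, pow_zero]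
  refine HasDerivAt.add_const _ (HasDerivAt.fun_sum fun k _ => ?_)
  refine HasDerivAt.mul_const ?_ (x (k + 1))
  refine ((hasDerivAt_pow (k + 1) t).div_const _).congr_deriv ?_
  rw [Nat.factorial_succ, Nat.add_sub_cancel]
  push_cast
  field_simp

/-- The terms of the exponential series for the `n`-th derivative at `0` of `exp (t Δ_{θ,ω})`
applied to `z ↦ exp (b z)`. -/
def flowTerm (θ ω b t : ℝ) (n k : ℕ) : ℝ :=
  t ^ k / k.factorial * (seqDelta θ ω ^ k) (fun m => b ^ m) n

theorem flowTerm_nonneg (hθ : 0 ≤ θ) (hω : 0 ≤ ω) (hb : 0 ≤ b) (ht : 0 ≤ t) (n k : ℕ) :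
    0 ≤ flowTerm θ ω b t n k := by
  have : (0 : ℕ → ℝ) ≤ fun m => b ^ m := fun m => pow_nonneg hb m
  refine mul_nonneg (by positivity) ?_
  simpa using seqDelta_pow_mono hθ hω k this n

theorem seqDelta_sum_flowTerm (θ ω b t : ℝ) (N n : ℕ) :
    seqDelta θ ω (fun m => ∑ k ∈ Finset.range N, flowTerm θ ω b t m k) n =
      ∑ k ∈ Finset.range N,
        t ^ k / k.factorial * (seqDelta θ ω ^ (k + 1)) (fun m => b ^ m) n := by
  have hsum : (fun m => ∑ k ∈ Finset.range N, flowTerm θ ω b t m k) =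
      ∑ k ∈ Finset.range N, (t ^ k / k.factorial) • (seqDelta θ ω ^ k) (fun m => b ^ m) := by
    ext m
    simp [flowTerm]
  rw [hsum]
  simp [pow_succ']

-- Both sides solve `u' = Δ u` with the same initial value, up to delaying the partial sum by one
-- term; since `Δ` is monotone, the comparison principle applies inductively.
theorem sum_flowTerm_le (hθ : 0 ≤ θ) (hω : 0 ≤ ω) (hb : 0 ≤ b) (hab : b * expQuot a ω < 1)
    (N : ℕ) (ht : t ∈ Set.Icc 0 a) (n : ℕ) :
    ∑ k ∈ Finset.range N, flowTerm θ ω b t n k ≤ flowCoeff θ ω b t n := by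
  have hlt : ∀ t ≤ a, b * expQuot t ω < 1 := fun t ht =>
    (mul_le_mul_of_nonneg_left (expQuot_mono ω ht) hb).trans_lt hab
  induction N generalizing t n with
  | zero => simpa using flowCoeff_nonneg hb (hlt t ht.2) n
  | succ N ih =>
    have hsum : ∀ t, HasDerivAt (fun t => ∑ k ∈ Finset.range (N + 1), flowTerm θ ω b t n k)
        (seqDelta θ ω (fun m => ∑ k ∈ Finset.range N, flowTerm θ ω b t m k) n) t := fun t => by
      rw [seqDelta_sum_flowTerm]
      exact hasDerivAt_sum_pow_div_factorial _ N t
    have hflow : ∀ t ≤ a, HasDerivAt (fun t => flowCoeff θ ω b t n)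
        (seqDelta θ ω (flowCoeff θ ω b t) n) t := fun t ht => hasDerivAt_flowCoeff θ (hlt t ht) n
    have hderiv : ∀ t ∈ Set.Ico 0 a,
        seqDelta θ ω (fun m => ∑ k ∈ Finset.range N, flowTerm θ ω b t m k) n ≤
          seqDelta θ ω (flowCoeff θ ω b t) n := fun t ht => by
      simpa using seqDelta_pow_mono hθ hω 1 (fun m => ih ⟨ht.1, ht.2.le⟩ m) n
    refine image_le_of_deriv_right_le_deriv_boundary
      (fun t _ => (hsum t).continuousAt.continuousWithinAt)
      (fun t _ => (hsum t).hasDerivWithinAt) ?_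
      (fun t ht => (hflow t ht.2).continuousAt.continuousWithinAt)
      (fun t ht => (hflow t ht.2.le).hasDerivWithinAt) hderiv ht
    rw [flowCoeff_zero, Finset.sum_range_succ']
    simp [flowTerm]

theorem summable_flowTerm (hθ : 0 ≤ θ) (hω : 0 ≤ ω) (ha : 0 ≤ a) (hb : 0 ≤ b)
    (hab : b * expQuot a ω < 1) (n : ℕ) : Summable (flowTerm θ ω b a n) :=
  summable_of_sum_range_le (flowTerm_nonneg hθ hω hb ha n)
    fun N => sum_flowTerm_le hθ hω hb hab N ⟨ha, le_rfl⟩ n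

theorem tsum_flowTerm_le (hθ : 0 ≤ θ) (hω : 0 ≤ ω) (ha : 0 ≤ a) (hb : 0 ≤ b)
    (hab : b * expQuot a ω < 1) (n : ℕ) : ∑' k, flowTerm θ ω b a n k ≤ flowCoeff θ ω b a n :=
  Real.tsum_le_of_sum_range_le (flowTerm_nonneg hθ hω hb ha n)
    fun N => sum_flowTerm_le hθ hω hb hab N ⟨ha, le_rfl⟩ n

theorem summable_flowTerm_mul_pow (hθ : 0 ≤ θ) (hω : 0 ≤ ω) (ha : 0 ≤ a) (hb : 0 ≤ b)
    (hab : b * expQuot a ω < 1) {x : ℝ} (hx : 0 ≤ x) :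
    Summable fun q : ℕ × ℕ => flowTerm θ ω b a q.1 q.2 * (x ^ q.1 / q.1.factorial) := by
  have hnonneg := flowTerm_nonneg hθ hω hb ha
  have hgeom : Summable fun n : ℕ => flowCoeff θ ω b a n * (x ^ n / n.factorial) := by
    refine ((Real.summable_pow_div_factorial (outType a ω b * x)).mul_left
      ((1 - b * expQuot a ω) ^ (-θ))).congr fun n => ?_
    rw [flowCoeff, mul_pow]
    ring
  have hprod : (0 : ℕ × ℕ → ℝ) ≤
      fun q => flowTerm θ ω b a q.1 q.2 * (x ^ q.1 / q.1.factorial) :=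
    fun q => mul_nonneg (hnonneg q.1 q.2) (by positivity)
  rw [summable_prod_of_nonneg hprod]
  simp only [tsum_mul_right]
  refine ⟨fun n => (summable_flowTerm hθ hω ha hb hab n).mul_right (x ^ n / n.factorial), ?_⟩
  exact hgeom.of_nonneg_of_le (fun n => mul_nonneg (tsum_nonneg (hnonneg n)) (by positivity))
    fun n => mul_le_mul_of_nonneg_right (tsum_flowTerm_le hθ hω ha hb hab n) (by positivity)

end Flow

section OperatorCoefficients

variable {θ ω a b M N : ℝ} {Φ F : ℕ → ℂ}

/-- The terms of the series for the `n`-th derivative at `0` of `φ(Δ_{θ,ω}) f`, where `Φ` and `F`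
are the sequences of derivatives at `0` of `φ` and `f`. -/
def opCoeffTerm (θ ω : ℝ) (Φ F : ℕ → ℂ) (n k : ℕ) : ℂ :=
  Φ k / k.factorial * (seqDelta (θ : ℂ) ω ^ k) F n

/-- The `n`-th derivative at `0` of `φ(Δ_{θ,ω}) f`, where `Φ` and `F` are the sequences of
derivatives at `0` of `φ` and `f`. -/
def opCoeff (θ ω : ℝ) (Φ F : ℕ → ℂ) (n : ℕ) : ℂ := ∑' k, opCoeffTerm θ ω Φ F n k

theorem norm_opCoeffTerm_le (hθ : 0 ≤ θ) (hω : 0 ≤ ω) (hΦ : ∀ k, ‖Φ k‖ ≤ M * a ^ k)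
    (hF : ∀ k, ‖F k‖ ≤ N * b ^ k) (n k : ℕ) :
    ‖opCoeffTerm θ ω Φ F n k‖ ≤ M * N * flowTerm θ ω b a n k := by
  have hpow : ‖(seqDelta (θ : ℂ) ω ^ k) F n‖ ≤ N * (seqDelta θ ω ^ k) (fun m => b ^ m) n :=
    calc ‖(seqDelta (θ : ℂ) ω ^ k) F n‖
        ≤ (seqDelta θ ω ^ k) (fun m => ‖F m‖) n := by
          simpa only [Complex.norm_of_nonneg, hθ, hω] using norm_seqDelta_pow_le (θ : ℂ) ω k F n
      _ ≤ (seqDelta θ ω ^ k) (N • fun m => b ^ m) n := seqDelta_pow_mono hθ hω k hF n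
      _ = N * (seqDelta θ ω ^ k) (fun m => b ^ m) n := by rw [map_smul]; rfl
  calc ‖opCoeffTerm θ ω Φ F n k‖
      = ‖Φ k‖ / k.factorial * ‖(seqDelta (θ : ℂ) ω ^ k) F n‖ := by simp [opCoeffTerm]
    _ ≤ M * a ^ k / k.factorial * (N * (seqDelta θ ω ^ k) (fun m => b ^ m) n) :=
        mul_le_mul (by gcongr; exact hΦ k) hpow (norm_nonneg _)
          (div_nonneg ((norm_nonneg _).trans (hΦ k)) (Nat.cast_nonneg _))
    _ = M * N * flowTerm θ ω b a n k := by
        rw [flowTerm]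
        ring

theorem summable_opCoeffTerm (hθ : 0 ≤ θ) (hω : 0 ≤ ω) (ha : 0 ≤ a) (hb : 0 ≤ b)
    (hab : b * expQuot a ω < 1) (hΦ : ∀ k, ‖Φ k‖ ≤ M * a ^ k) (hF : ∀ k, ‖F k‖ ≤ N * b ^ k)
    (n : ℕ) : Summable (opCoeffTerm θ ω Φ F n) :=
  ((summable_flowTerm hθ hω ha hb hab n).mul_left (M * N)).of_norm_bounded
    (norm_opCoeffTerm_le hθ hω hΦ hF n)

theorem norm_opCoeff_le (hθ : 0 ≤ θ) (hω : 0 ≤ ω) (ha : 0 ≤ a) (hb : 0 ≤ b)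
    (hab : b * expQuot a ω < 1) (hΦ : ∀ k, ‖Φ k‖ ≤ M * a ^ k) (hF : ∀ k, ‖F k‖ ≤ N * b ^ k)
    (n : ℕ) : ‖opCoeff θ ω Φ F n‖ ≤ M * N * flowCoeff θ ω b a n := by
  have hM : 0 ≤ M := by simpa using (norm_nonneg _).trans (hΦ 0)
  have hN : 0 ≤ N := by simpa using (norm_nonneg _).trans (hF 0)
  calc ‖opCoeff θ ω Φ F n‖ ≤ M * N * ∑' k, flowTerm θ ω b a n k :=
        tsum_of_norm_bounded ((summable_flowTerm hθ hω ha hb hab n).hasSum.mul_left (M * N))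
          (norm_opCoeffTerm_le hθ hω hΦ hF n)
    _ ≤ M * N * flowCoeff θ ω b a n := by
        gcongr
        exact tsum_flowTerm_le hθ hω ha hb hab n

theorem summable_opCoeffTerm_mul_pow (hθ : 0 ≤ θ) (hω : 0 ≤ ω) (ha : 0 ≤ a) (hb : 0 ≤ b)
    (hab : b * expQuot a ω < 1) (hΦ : ∀ k, ‖Φ k‖ ≤ M * a ^ k) (hF : ∀ k, ‖F k‖ ≤ N * b ^ k)
    (z : ℂ) :
    Summable fun q : ℕ × ℕ => opCoeffTerm θ ω Φ F q.1 q.2 * (z ^ q.1 / q.1.factorial) := by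
  refine ((summable_flowTerm_mul_pow hθ hω ha hb hab (norm_nonneg z)).mul_left
    (M * N)).of_norm_bounded fun q => ?_
  rw [norm_mul, norm_div, norm_pow, Complex.norm_natCast, ← mul_assoc]
  gcongr
  exact norm_opCoeffTerm_le hθ hω hΦ hF q.1 q.2

theorem exists_hasSum_opTerm_hasSum_opCoeff (hθ : 0 ≤ θ) (hω : 0 ≤ ω) (ha : 0 ≤ a) (hb : 0 ≤ b)
    (hab : b * expQuot a ω < 1) {φ f : ℂ → ℂ} (hf : Differentiable ℂ f)
    (hφM : ∀ k, ‖derivSeq φ k‖ ≤ M * a ^ k) (hfN : ∀ k, ‖derivSeq f k‖ ≤ N * b ^ k) (z : ℂ) :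
    ∃ y, HasSum (opTerm θ ω φ f z) y ∧
      HasSum (fun n => opCoeff θ ω (derivSeq φ) (derivSeq f) n * (z ^ n / n.factorial)) y := by
  have hsum := (summable_opCoeffTerm_mul_pow hθ hω ha hb hab hφM hfN z).hasSum
  have hrow : ∀ n, HasSum
      (fun k => opCoeffTerm θ ω (derivSeq φ) (derivSeq f) n k * (z ^ n / n.factorial))
      (opCoeff θ ω (derivSeq φ) (derivSeq f) n * (z ^ n / n.factorial)) := fun n =>
    (summable_opCoeffTerm hθ hω ha hb hab hφM hfN n).hasSum.mul_right _
  have hcol : ∀ k, HasSum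
      (fun n => opCoeffTerm θ ω (derivSeq φ) (derivSeq f) n k * (z ^ n / n.factorial))
      (opTerm θ ω φ f z k) := fun k => by
    simp only [opCoeffTerm, ← derivSeq_lagDelta_iterate hf, mul_assoc]
    exact (hasSum_derivSeq (differentiable_lagDelta_iterate hf θ ω k) z).mul_left _
  exact ⟨_, ((Equiv.prodComm ℕ ℕ).hasSum_iff.2 hsum).prod_fiberwise hcol, hsum.prod_fiberwise hrow⟩

end OperatorCoefficients
theorem ExpNormFinite.norm_derivSeq_le {b : ℝ} (hb : 0 < b) {f : ℂ → ℂ} (hf : ExpNormFinite b f)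
    (k : ℕ) : ‖derivSeq f k‖ ≤ expNorm b f * b ^ k := by
  have h := le_ciSup hf k
  rw [inv_mul_le_iff₀ (by positivity)] at h
  exact h.trans_eq (mul_comm _ _)

theorem expNormFinite_iff {b : ℝ} (hb : 0 < b) {f : ℂ → ℂ} :
    ExpNormFinite b f ↔ ∃ M, ∀ k, ‖derivSeq f k‖ ≤ M * b ^ k := by
  simp only [ExpNormFinite, bddAbove_def, Set.forall_mem_range, inv_mul_le_iff₀ (pow_pos hb _),
    mul_comm, derivSeq]

theorem summable_div_factorial_mul_pow {F : ℕ → ℂ} {M b : ℝ} (hF : ∀ k, ‖F k‖ ≤ M * b ^ k)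
    (z : ℂ) : Summable fun k => F k / k.factorial * z ^ k := by
  refine ((Real.summable_pow_div_factorial (b * ‖z‖)).mul_left M).of_norm_bounded fun k => ?_
  calc ‖F k / k.factorial * z ^ k‖ = ‖F k‖ / k.factorial * ‖z‖ ^ k := by simp
    _ ≤ M * b ^ k / k.factorial * ‖z‖ ^ k := by
        gcongr
        exact hF k
    _ = M * ((b * ‖z‖) ^ k / k.factorial) := by
        rw [mul_pow]
        ring

namespace ExpType

variable {a : ℝ}

/-- The map sending `f` to the sequence of its derivatives at `0`. -/
def derivSeqₗ (a : ℝ) : ExpType a →ₗ[ℂ] ℕ → ℂ where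
  toFun f := derivSeq f
  map_add' f g := funext fun k => iteratedDeriv_add_of_entire f.2.1 g.2.1 k
  map_smul' c f := funext fun k => iteratedDeriv_smul_at_zero f.1 c k

theorem derivSeq_add (f g : ExpType a) : derivSeq (f + g : ExpType a) = derivSeq f + derivSeq g :=
  map_add (derivSeqₗ a) f g

theorem derivSeq_sub (f g : ExpType a) : derivSeq (f - g : ExpType a) = derivSeq f - derivSeq g :=
  map_sub (derivSeqₗ a) f g

theorem derivSeq_smul (c : ℂ) (f : ExpType a) : derivSeq (c • f : ExpType a) = c • derivSeq f :=
  map_smul (derivSeqₗ a) c f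

theorem ext_derivSeq {f g : ExpType a} (h : derivSeq f = derivSeq g) : f = g :=
  Subtype.ext <| funext fun z =>
    (hasSum_derivSeq f.2.1 z).unique (h ▸ hasSum_derivSeq g.2.1 z)

theorem norm_derivSeq_le (f : ExpType a) (b : {b : ℝ // 0 < b ∧ a < b}) (k : ℕ) :
    ‖derivSeq f k‖ ≤ expSeminorm a b f * (b : ℝ) ^ k :=
  (f.2.2 b b.2.1 b.2.2).norm_derivSeq_le b.2.1 k

theorem expSeminorm_le (f : ExpType a) (b : {b : ℝ // 0 < b ∧ a < b}) {M : ℝ}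
    (h : ∀ k, ‖derivSeq f k‖ ≤ M * (b : ℝ) ^ k) : expSeminorm a b f ≤ M := by
  refine ciSup_le fun k => ?_
  rw [inv_mul_le_iff₀ (pow_pos b.2.1 k), mul_comm]
  exact h k

/-- The element of `𝒜_a` with a given sequence of derivatives at `0`. -/
def ofDerivSeq (F : ℕ → ℂ) (hF : ∀ b : {b : ℝ // 0 < b ∧ a < b}, ∃ M, ∀ k, ‖F k‖ ≤ M * b ^ k) :
    ExpType a :=
  have hsum : ∀ z, HasSum (fun k => F k / k.factorial * z ^ k)
      (∑' k, F k / k.factorial * z ^ k) := fun z =>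
    let ⟨_, hM⟩ := hF (Classical.arbitrary _)
    (summable_div_factorial_mul_pow hM z).hasSum
  ⟨fun z => ∑' k, F k / k.factorial * z ^ k, differentiable_of_hasSum hsum, fun b hb hab => by
    simpa [expNormFinite_iff hb, derivSeq_of_hasSum hsum, mul_div_cancel₀,
      Nat.factorial_ne_zero] using hF ⟨b, hb, hab⟩⟩

theorem derivSeq_ofDerivSeq (F : ℕ → ℂ)
    (hF : ∀ b : {b : ℝ // 0 < b ∧ a < b}, ∃ M, ∀ k, ‖F k‖ ≤ M * b ^ k) :
    derivSeq (ofDerivSeq F hF) = F := by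
  obtain ⟨_, hM⟩ := hF (Classical.arbitrary _)
  ext k
  exact (derivSeq_of_hasSum (fun z => (summable_div_factorial_mul_pow hM z).hasSum) k).trans
    (mul_div_cancel₀ _ (Nat.cast_ne_zero.2 k.factorial_ne_zero))

/-- A polynomial as an element of `𝒜_a`. -/
def ofPolynomial (a : ℝ) (p : ℂ[X]) : ExpType a :=
  ⟨fun z => p.eval z, p.differentiable, fun b _ _ => by
    refine Tendsto.bddAbove_range (tendsto_const_nhds (x := (0 : ℝ)).congr' ?_)
    filter_upwards [eventually_gt_atTop p.natDegree] with k hk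
    rw [← derivSeq, derivSeq_eval, coeff_eq_zero_of_natDegree_lt hk, mul_zero, norm_zero,
      mul_zero]⟩

theorem norm_apply_le (f : ExpType a) (b : {b : ℝ // 0 < b ∧ a < b}) (z : ℂ) :
    ‖f z‖ ≤ expSeminorm a b f * Real.exp (b * ‖z‖) := by
  have hexp := (NormedSpace.expSeries_div_hasSum_exp ((b : ℝ) * ‖z‖)).mul_left (expSeminorm a b f)
  rw [← Real.exp_eq_exp_ℝ] at hexp
  refine (hasSum_derivSeq f.2.1 z).norm_le_of_bounded hexp fun k => ?_
  calc ‖derivSeq f k * (z ^ k / k.factorial)‖ = ‖derivSeq f k‖ * (‖z‖ ^ k / k.factorial) := by simp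
    _ ≤ expSeminorm a b f * (b : ℝ) ^ k * (‖z‖ ^ k / k.factorial) := by
        gcongr
        exact f.norm_derivSeq_le b k
    _ = expSeminorm a b f * ((b * ‖z‖) ^ k / k.factorial) := by
        rw [mul_pow]
        ring

theorem continuous_apply (z : ℂ) : Continuous fun f : ExpType a => f z := by
  let b : {b : ℝ // 0 < b ∧ a < b} := Classical.arbitrary _
  refine WithSeminorms.continuous_normedSpace_rng ℂ (expType_withSeminorms a)
    ((LinearMap.proj z : (ℂ → ℂ) →ₗ[ℂ] ℂ) ∘ₗ (expTypeSubmodule a).subtype)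
    ⟨{b}, (Real.exp (b * ‖z‖)).toNNReal, fun f => ?_⟩
  rw [Finset.sup_singleton]
  change ‖f z‖ ≤ (Real.exp (b * ‖z‖)).toNNReal * expSeminorm a b f
  rw [Real.coe_toNNReal _ (Real.exp_nonneg _), mul_comm]
  exact f.norm_apply_le b z

theorem summable_norm_derivSeq_div_pow (f : ExpType a) (b : {b : ℝ // 0 < b ∧ a < b}) :
    Summable fun k => ‖derivSeq f k‖ / (b : ℝ) ^ k := by
  obtain ⟨c, hc, hcb⟩ := exists_between (max_lt b.2.1 b.2.2)
  obtain ⟨hc0, hac⟩ := max_lt_iff.1 hc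
  have hgeom : Summable fun k => (c / b) ^ k :=
    summable_geometric_of_lt_one (div_nonneg hc0.le b.2.1.le) ((div_lt_one b.2.1).2 hcb)
  refine (hgeom.mul_left (expSeminorm a ⟨c, hc0, hac⟩ f)).of_nonneg_of_le
    (fun k => div_nonneg (norm_nonneg _) (pow_nonneg b.2.1.le k)) fun k => ?_
  rw [div_pow, ← mul_div_assoc]
  exact div_le_div_of_nonneg_right (f.norm_derivSeq_le ⟨c, hc0, hac⟩ k) (pow_nonneg b.2.1.le k)

theorem expSeminorm_le_tsum (f : ExpType a) (b : {b : ℝ // 0 < b ∧ a < b}) :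
    expSeminorm a b f ≤ ∑' k, ‖derivSeq f k‖ / (b : ℝ) ^ k := by
  refine f.expSeminorm_le b fun k => ?_
  rw [← div_le_iff₀ (pow_pos b.2.1 k)]
  exact (f.summable_norm_derivSeq_div_pow b).le_tsum k
    fun n _ => div_nonneg (norm_nonneg _) (pow_nonneg b.2.1.le n)

theorem tendsto_of_dominated {ι : Type*} {l : Filter ι} {F : ι → ExpType a} {f : ExpType a}
    (hbound : ∀ i k, ‖derivSeq (F i) k‖ ≤ ‖derivSeq f k‖)
    (hlim : ∀ k, Tendsto (fun i => derivSeq (F i) k) l (𝓝 (derivSeq f k))) :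
    Tendsto F l (𝓝 f) := by
  rw [(expType_withSeminorms a).tendsto_nhds]
  intro b ε hε
  have hterm : ∀ k, Tendsto (fun i => ‖derivSeq (F i - f : ExpType a) k‖ / (b : ℝ) ^ k) l
      (𝓝 0) := fun k => by
    simpa [derivSeq_sub] using ((hlim k).sub_const (derivSeq f k)).norm.div_const ((b : ℝ) ^ k)
  have hdom : ∀ i k, ‖‖derivSeq (F i - f : ExpType a) k‖ / (b : ℝ) ^ k‖ ≤
      2 * (‖derivSeq f k‖ / (b : ℝ) ^ k) := fun i k => by
    rw [norm_div, norm_norm, norm_pow, Real.norm_of_nonneg b.2.1.le, ← mul_div_assoc, two_mul,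
      derivSeq_sub]
    refine div_le_div_of_nonneg_right ?_ (pow_nonneg b.2.1.le k)
    exact (norm_sub_le _ _).trans (add_le_add_left (hbound i k) _)
  have htsum : Tendsto (fun i => ∑' k, ‖derivSeq (F i - f : ExpType a) k‖ / (b : ℝ) ^ k) l
      (𝓝 0) := by
    simpa using tendsto_tsum_of_dominated_convergence
      ((f.summable_norm_derivSeq_div_pow b).mul_left 2) hterm (Eventually.of_forall hdom)
  filter_upwards [htsum.eventually_lt_const hε] with i hi
  exact ((F i - f).expSeminorm_le_tsum b).trans_lt hi

end ExpType

theorem continuous_of_seminorm_le_mul {𝕜 E F G ι κ τ : Type*} [NontriviallyNormedField 𝕜]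
    [AddCommGroup E] [Module 𝕜 E] [TopologicalSpace E] [AddCommGroup F] [Module 𝕜 F]
    [TopologicalSpace F] [AddCommGroup G] [Module 𝕜 G] [TopologicalSpace G]
    {p : SeminormFamily 𝕜 E ι} {q : SeminormFamily 𝕜 F κ} {r : SeminormFamily 𝕜 G τ}
    (hp : WithSeminorms p) (hq : WithSeminorms q) (hr : WithSeminorms r) (B : E →ₗ[𝕜] F →ₗ[𝕜] G)
    (hB : ∀ i, ∃ j k, ∃ K : ℝ, ∀ x y, r i (B x y) ≤ K * (p j x * q k y)) :
    Continuous fun x : E × F => B x.1 x.2 := by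
  have := hp.topologicalAddGroup
  have := hq.topologicalAddGroup
  refine continuous_iff_continuousAt.2 fun ⟨x₀, y₀⟩ => (hr.tendsto_nhds _ _).2 fun i ε hε => ?_
  obtain ⟨j, k, K, hK⟩ := hB i
  have hpj := hp.continuous_seminorm j
  have hqk := hq.continuous_seminorm k
  have hlim : Tendsto (fun x : E × F =>
      K * (p j (x.1 - x₀) * q k x.2) + K * (p j x₀ * q k (x.2 - y₀))) (𝓝 (x₀, y₀)) (𝓝 0) := by
    refine Continuous.tendsto' (by fun_prop) _ _ (by simp)
  filter_upwards [hlim.eventually_lt_const hε] with x hx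
  calc r i (B x.1 x.2 - B x₀ y₀) = r i (B (x.1 - x₀) x.2 + B x₀ (x.2 - y₀)) := by simp
    _ ≤ r i (B (x.1 - x₀) x.2) + r i (B x₀ (x.2 - y₀)) := map_add_le_add _ _ _
    _ ≤ K * (p j (x.1 - x₀) * q k x.2) + K * (p j x₀ * q k (x.2 - y₀)) :=
        add_le_add (hK _ _) (hK _ _)
    _ < ε := hx

section Operator

variable {θ ω a b : ℝ}

theorem continuous_expQuot (ω : ℝ) : Continuous fun t => expQuot t ω :=
  continuous_iff_continuousAt.2 fun t => (hasDerivAt_expQuot ω t).continuousAt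

theorem exists_gt_outType_lt {c : ℝ} (ha : 0 ≤ a) (hb : 0 ≤ b) (hab : b * expQuot a ω < 1)
    (hc : outType a ω b < c) :
    ∃ (a' : {x : ℝ // 0 < x ∧ a < x}) (b' : {x : ℝ // 0 < x ∧ b < x}),
      (b' : ℝ) * expQuot a' ω < 1 ∧ outType a' ω b' < c := by
  have hquot : Continuous fun ε : ℝ => (b + ε) * expQuot (a + ε) ω :=
    (continuous_const_add b).mul ((continuous_expQuot ω).comp (continuous_const_add a))
  have hout : ContinuousAt (fun ε : ℝ => outType (a + ε) ω (b + ε)) 0 := by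
    refine ContinuousAt.mul (by fun_prop) ((continuousAt_const.sub hquot.continuousAt).inv₀ ?_)
    simpa using (sub_pos.2 hab).ne'
  have hquot_lt : ∀ᶠ ε in 𝓝[>] (0 : ℝ), (b + ε) * expQuot (a + ε) ω < 1 :=
    nhdsWithin_le_nhds (hquot.continuousAt.eventually_lt_const (by simpa using hab))
  have hout_lt : ∀ᶠ ε in 𝓝[>] (0 : ℝ), outType (a + ε) ω (b + ε) < c :=
    nhdsWithin_le_nhds (hout.eventually_lt_const (by simpa using hc))
  obtain ⟨ε, hε₁, hε₂, hε⟩ := (hquot_lt.and (hout_lt.and self_mem_nhdsWithin)).exists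
  exact ⟨⟨a + ε, add_pos_of_nonneg_of_pos ha hε, lt_add_of_pos_right a hε⟩,
    ⟨b + ε, add_pos_of_nonneg_of_pos hb hε, lt_add_of_pos_right b hε⟩, hε₁, hε₂⟩

theorem exists_norm_opCoeff_le (hθ : 0 ≤ θ) (hω : 0 ≤ ω) (ha : 0 ≤ a) (hb : 0 ≤ b)
    (hab : b * expQuot a ω < 1)
    (c : {c : ℝ // 0 < c ∧ outType a ω b < c}) :
    ∃ a' b', ∃ K : ℝ, ∀ (φ : ExpType a) (f : ExpType b) n,
      ‖opCoeff θ ω (derivSeq φ) (derivSeq f) n‖ ≤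
        K * (expSeminorm a a' φ * expSeminorm b b' f) * (c : ℝ) ^ n := by
  obtain ⟨a', b', hab', hc⟩ := exists_gt_outType_lt ha hb hab c.2.2
  refine ⟨a', b', (1 - b' * expQuot a' ω) ^ (-θ), fun φ f n => ?_⟩
  have hle := norm_opCoeff_le hθ hω a'.2.1.le b'.2.1.le hab' (φ.norm_derivSeq_le a')
    (f.norm_derivSeq_le b') n
  refine hle.trans ?_
  have : 0 ≤ outType a' ω b' := outType_nonneg b'.2.1.le hab'
  have : 0 < 1 - b' * expQuot a' ω := sub_pos.2 hab'
  rw [flowCoeff, ← mul_assoc, mul_comm ((_ : ℝ) ^ (-θ))]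
  gcongr

theorem summable_opCoeffTerm_derivSeq (hθ : 0 ≤ θ) (hω : 0 ≤ ω) (ha : 0 ≤ a) (hb : 0 ≤ b)
    (hab : b * expQuot a ω < 1)
    (φ : ExpType a) (f : ExpType b) (n : ℕ) :
    Summable (opCoeffTerm θ ω (derivSeq φ) (derivSeq f) n) := by
  obtain ⟨a', b', hab', -⟩ := exists_gt_outType_lt ha hb hab (lt_add_one _)
  exact summable_opCoeffTerm hθ hω a'.2.1.le b'.2.1.le hab' (φ.norm_derivSeq_le a')
    (f.norm_derivSeq_le b') n

/-- The bilinear map `(φ, f) ↦ φ(Δ_{θ,ω}) f` from `𝒜_a × 𝒜_b` to `𝒜_c`, defined through its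
sequence of derivatives at `0`. -/
def opMap (hθ : 0 ≤ θ) (hω : 0 ≤ ω) (ha : 0 ≤ a) (hb : 0 ≤ b)
    (hab : b * expQuot a ω < 1) :
    ExpType a →ₗ[ℂ] ExpType b →ₗ[ℂ] ExpType (outType a ω b) :=
  LinearMap.mk₂ ℂ
    (fun φ f => .ofDerivSeq (opCoeff θ ω (derivSeq φ) (derivSeq f)) fun c =>
      let ⟨_, _, _, h⟩ := exists_norm_opCoeff_le hθ hω ha hb hab c
      ⟨_, h φ f⟩)
    (fun φ₁ φ₂ f => ExpType.ext_derivSeq <| funext fun n => by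
      simp only [ExpType.derivSeq_ofDerivSeq, ExpType.derivSeq_add, Pi.add_apply, opCoeff,
        opCoeffTerm, add_div, add_mul]
      exact (summable_opCoeffTerm_derivSeq hθ hω ha hb hab φ₁ f n).tsum_add
        (summable_opCoeffTerm_derivSeq hθ hω ha hb hab φ₂ f n))
    (fun x φ f => ExpType.ext_derivSeq <| funext fun n => by
      simp only [ExpType.derivSeq_ofDerivSeq, ExpType.derivSeq_smul, Pi.smul_apply, opCoeff,
        opCoeffTerm, smul_eq_mul, mul_div_assoc, mul_assoc, tsum_mul_left])
    (fun φ f₁ f₂ => ExpType.ext_derivSeq <| funext fun n => by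
      simp only [ExpType.derivSeq_ofDerivSeq, ExpType.derivSeq_add, Pi.add_apply, opCoeff,
        opCoeffTerm, map_add, mul_add]
      exact (summable_opCoeffTerm_derivSeq hθ hω ha hb hab φ f₁ n).tsum_add
        (summable_opCoeffTerm_derivSeq hθ hω ha hb hab φ f₂ n))
    (fun x φ f => ExpType.ext_derivSeq <| funext fun n => by
      simp only [ExpType.derivSeq_ofDerivSeq, ExpType.derivSeq_smul, Pi.smul_apply, opCoeff,
        opCoeffTerm, map_smul, smul_eq_mul, mul_left_comm _ x, tsum_mul_left])

theorem derivSeq_opMap (hθ : 0 ≤ θ) (hω : 0 ≤ ω) (ha : 0 ≤ a) (hb : 0 ≤ b)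
    (hab : b * expQuot a ω < 1) (φ : ExpType a) (f : ExpType b) :
    derivSeq (opMap hθ hω ha hb hab φ f) = opCoeff θ ω (derivSeq φ) (derivSeq f) := by
  simp only [opMap, LinearMap.mk₂_apply, ExpType.derivSeq_ofDerivSeq]

theorem hasSum_opTerm (hθ : 0 ≤ θ) (hω : 0 ≤ ω) (ha : 0 ≤ a) (hb : 0 ≤ b)
    (hab : b * expQuot a ω < 1) (φ : ExpType a) (f : ExpType b) (z : ℂ) :
    HasSum (opTerm θ ω φ f z) (opMap hθ hω ha hb hab φ f z) := by
  obtain ⟨a', b', hab', -⟩ := exists_gt_outType_lt ha hb hab (lt_add_one _)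
  obtain ⟨y, hy, hy'⟩ := exists_hasSum_opTerm_hasSum_opCoeff hθ hω a'.2.1.le b'.2.1.le hab' f.2.1
    (φ.norm_derivSeq_le a') (f.norm_derivSeq_le b') z
  rw [← derivSeq_opMap hθ hω ha hb hab] at hy'
  exact hy'.unique (hasSum_derivSeq (opMap hθ hω ha hb hab φ f).2.1 z) ▸ hy

theorem opMap_ofPolynomial (hθ : 0 ≤ θ) (hω : 0 ≤ ω) (ha : 0 ≤ a) (hb : 0 ≤ b)
    (hab : b * expQuot a ω < 1) (φ p : ℂ[X]) (z : ℂ) :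
    opMap hθ hω ha hb hab (.ofPolynomial a φ) (.ofPolynomial b p) z =
      (aeval (polyDelta θ ω) φ p).eval z :=
  (hasSum_opTerm hθ hω ha hb hab _ _ z).unique (hasSum_opTerm_eval θ ω φ p z)

theorem continuous_opMap (hθ : 0 ≤ θ) (hω : 0 ≤ ω) (ha : 0 ≤ a) (hb : 0 ≤ b)
    (hab : b * expQuot a ω < 1) :
    Continuous fun q : ExpType a × ExpType b => opMap hθ hω ha hb hab q.1 q.2 := by
  refine continuous_of_seminorm_le_mul (expType_withSeminorms a) (expType_withSeminorms b)
    (expType_withSeminorms _) _ fun c => ?_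
  obtain ⟨a', b', K, hK⟩ := exists_norm_opCoeff_le hθ hω ha hb hab c
  refine ⟨a', b', K, fun φ f => ExpType.expSeminorm_le _ c ?_⟩
  rw [derivSeq_opMap]
  exact hK φ f

end Operator

section Approximation

theorem coeff_le_coeff_add {R : Type*} [Semiring R] [PartialOrder R] [CanonicallyOrderedAdd R]
    (p q : R[X]) : p.coeff ≤ (p + q).coeff := fun k => by
  rw [coeff_add]
  exact le_self_add

theorem coeff_mul_le_coeff_mul {p p' q q' : ℝ≥0[X]} (hp : p.coeff ≤ p'.coeff)
    (hq : q.coeff ≤ q'.coeff) : (p * q).coeff ≤ (p' * q').coeff := fun k => by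
  simp only [coeff_mul]
  exact Finset.sum_le_sum fun i _ => mul_le_mul' (hp _) (hq _)

theorem coeff_pow_le_coeff_pow {p q : ℝ≥0[X]} (h : p.coeff ≤ q.coeff) (n : ℕ) :
    (p ^ n).coeff ≤ (q ^ n).coeff := by
  induction n with
  | zero => simp
  | succ n ih => simpa only [pow_succ] using coeff_mul_le_coeff_mul ih h

/-- Polynomials approximating `z^m e^{α z} ∏_j (1 + β_j z)`. The exponents `2 ^ n` make the
coefficients increase with `n`. -/
def approxPoly (m : ℕ) (α : ℝ≥0) (β : ℕ → ℝ≥0) (n : ℕ) : ℝ≥0[X] :=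
  X ^ m * (1 + C (α / 2 ^ n) * X) ^ 2 ^ n * ∏ j ∈ Finset.range n, (1 + C (β j) * X)

theorem monotone_coeff_approxPoly (m : ℕ) (α : ℝ≥0) (β : ℕ → ℝ≥0) :
    Monotone fun n => (approxPoly m α β n).coeff := by
  refine monotone_nat_of_le_succ fun n => ?_
  have hexp : ((1 + C (α / 2 ^ n) * X) ^ 2 ^ n : ℝ≥0[X]).coeff ≤
      ((1 + C (α / 2 ^ (n + 1)) * X) ^ 2 ^ (n + 1) : ℝ≥0[X]).coeff := by
    have hsq : (1 + C (α / 2 ^ (n + 1)) * X) ^ 2 =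
        (1 + C (α / 2 ^ n) * X : ℝ≥0[X]) + (C (α / 2 ^ (n + 1)) * X) ^ 2 := by
      have : C (α / 2 ^ n) = 2 * C (α / 2 ^ (n + 1)) := by
        rw [← C_ofNat, ← C_mul]
        congr 1
        field_simp
        ring
      rw [this]
      ring
    have hpow : (1 + C (α / 2 ^ (n + 1)) * X : ℝ≥0[X]) ^ 2 ^ (n + 1) =
        ((1 + C (α / 2 ^ (n + 1)) * X) ^ 2) ^ 2 ^ n := by
      rw [← pow_mul, ← pow_succ']
    rw [hpow, hsq]
    exact coeff_pow_le_coeff_pow (coeff_le_coeff_add _ _) _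
  have hprod : (∏ j ∈ Finset.range n, (1 + C (β j) * X)).coeff ≤
      (∏ j ∈ Finset.range (n + 1), (1 + C (β j) * X)).coeff := by
    rw [Finset.prod_range_succ, mul_add, mul_one]
    exact coeff_le_coeff_add _ _
  exact coeff_mul_le_coeff_mul (coeff_mul_le_coeff_mul le_rfl hexp) hprod

theorem algebraMap_nnreal_complex (x : ℝ≥0) : algebraMap ℝ≥0 ℂ x = ((x : ℝ) : ℂ) := rfl

theorem nonposRooted_map_approxPoly (m : ℕ) (α : ℝ≥0) (β : ℕ → ℝ≥0) (n : ℕ) :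
    NonposRooted ((approxPoly m α β n).map (algebraMap ℝ≥0 ℂ)) := by
  have hlin : ∀ x : ℝ≥0, NonposRooted ((1 + C x * X).map (algebraMap ℝ≥0 ℂ)) := fun x => by
    simpa [algebraMap_nnreal_complex] using NonposRooted.one_add_C_mul_X x.2
  simp only [approxPoly, Polynomial.map_mul, Polynomial.map_pow, Polynomial.map_prod, map_X]
  exact ((NonposRooted.X.pow m).mul ((hlin _).pow _)).mul (.prod fun j _ => hlin (β j))

theorem tendsto_aeval_approxPoly (m : ℕ) (α : ℝ≥0) {β : ℕ → ℝ≥0}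
    (hβ : Summable fun j => (β j : ℝ)) (z : ℂ) :
    Tendsto (fun n => aeval z (approxPoly m α β n)) atTop
      (𝓝 (z ^ m * Complex.exp ((α : ℝ) * z) * ∏' j, (1 + ((β j : ℝ) : ℂ) * z))) := by
  have hexp : Tendsto (fun n : ℕ => (1 + ((α : ℝ) : ℂ) / 2 ^ n * z) ^ 2 ^ n) atTop
      (𝓝 (Complex.exp ((α : ℝ) * z))) := by
    refine ((Complex.tendsto_one_add_div_pow_exp ((α : ℝ) * z)).comp
      (tendsto_pow_atTop_atTop_of_one_lt one_lt_two)).congr fun n => ?_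
    simp only [Function.comp_apply, Nat.cast_pow, Nat.cast_ofNat]
    ring_nf
  have hprod := (multipliable_one_add_ofReal_mul hβ z).hasProd.tendsto_prod_nat
  refine ((tendsto_const_nhds.mul hexp).mul hprod).congr fun n => ?_
  simp [approxPoly, algebraMap_nnreal_complex]

theorem nnnorm_aeval_algebraMap (p : ℝ≥0[X]) (x : ℝ≥0) :
    ‖aeval (algebraMap ℝ≥0 ℂ x) p‖₊ = p.eval x := by
  rw [aeval_algebraMap_apply, coe_aeval_eq_eval, nnnorm_algebraMap_nnreal]

theorem exists_tendsto_coeff {P : ℕ → ℝ≥0[X]} (hP : Monotone fun n => (P n).coeff)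
    (hbdd : ∀ x, BddAbove (Set.range fun n => (P n).eval x)) :
    ∃ c : ℕ → ℝ≥0, (∀ n, (P n).coeff ≤ c) ∧
      (∀ k, Tendsto (fun n => (P n).coeff k) atTop (𝓝 (c k))) ∧
      ∀ x, Summable fun k => c k * x ^ k := by
  choose S hS using hbdd
  have hsum : ∀ x n s, ∑ k ∈ s, (P n).coeff k * x ^ k ≤ S x := fun x n s =>
    (sum_le_hasSum s (fun _ _ => zero_le) (hasSum_coeff_mul_pow (P n) x)).trans (hS x ⟨n, rfl⟩)
  have hcoeff : ∀ k, BddAbove (Set.range fun n => (P n).coeff k) := fun k =>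
    ⟨S 1, Set.forall_mem_range.2 fun n => by simpa using hsum 1 n {k}⟩
  have hlim : ∀ k, Tendsto (fun n => (P n).coeff k) atTop (𝓝 (⨆ n, (P n).coeff k)) := fun k =>
    tendsto_atTop_ciSup (fun _ _ h => hP h k) (hcoeff k)
  refine ⟨fun k => ⨆ n, (P n).coeff k, fun n k => le_ciSup (hcoeff k) n, hlim, fun x => ?_⟩
  refine NNReal.summable_coe.1 (summable_of_sum_le (c := S x) (fun _ => NNReal.coe_nonneg _)
    fun s => ?_)
  norm_cast
  exact le_of_tendsto' (tendsto_finsetSum s fun k _ => (hlim k).mul_const (x ^ k)) (hsum x · s)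

theorem exists_hasSum_of_tendsto_aeval {P : ℕ → ℝ≥0[X]} {h : ℂ → ℂ}
    (hP : Monotone fun n => (P n).coeff)
    (hlim : ∀ z, Tendsto (fun n => aeval z (P n)) atTop (𝓝 (h z))) :
    ∃ c : ℕ → ℝ≥0, (∀ n, (P n).coeff ≤ c) ∧
      (∀ k, Tendsto (fun n => (P n).coeff k) atTop (𝓝 (c k))) ∧
      ∀ z, HasSum (fun k => algebraMap ℝ≥0 ℂ (c k) * z ^ k) (h z) := by
  have hbdd : ∀ x, BddAbove (Set.range fun n => (P n).eval x) := fun x => by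
    simpa only [nnnorm_aeval_algebraMap] using (hlim (algebraMap ℝ≥0 ℂ x)).nnnorm.bddAbove_range
  obtain ⟨c, hle, hc, hsum⟩ := exists_tendsto_coeff hP hbdd
  refine ⟨c, hle, hc, fun z => ?_⟩
  have hnorm : ∀ x k, ‖algebraMap ℝ≥0 ℂ x * z ^ k‖ = (x * ‖z‖₊ ^ k : ℝ≥0) := fun x k => by
    simp [norm_algebraMap_nnreal]
  have hsummable : Summable fun k => ((c k * ‖z‖₊ ^ k : ℝ≥0) : ℝ) :=
    NNReal.summable_coe.2 (hsum ‖z‖₊)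
  have htsum : ∀ n, ∑' k, algebraMap ℝ≥0 ℂ ((P n).coeff k) * z ^ k = aeval z (P n) := fun n => by
    simpa using (hasSum_coeff_mul_pow ((P n).map (algebraMap ℝ≥0 ℂ)) z).tsum_eq
  have hdom : Tendsto (fun n => aeval z (P n)) atTop
      (𝓝 (∑' k, algebraMap ℝ≥0 ℂ (c k) * z ^ k)) := by
    simp only [← htsum]
    refine tendsto_tsum_of_dominated_convergence hsummable (fun k => ?_)
      (Eventually.of_forall fun n k => ?_)
    · exact (((continuous_algebraMap ℝ≥0 ℂ).tendsto _).comp (hc k)).mul_const _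
    · rw [hnorm]
      exact_mod_cast mul_le_mul_left (hle n k) _
  rw [tendsto_nhds_unique (hlim z) hdom]
  exact (hsummable.of_norm_bounded fun k => (hnorm _ k).le).hasSum

theorem ExpType.exists_tendsto_ofPolynomial {b : ℝ} {f : ExpType b} (hf : f ∈ laguerrePlus b) :
    ∃ p : ℕ → ℂ[X], (∀ n, NonposRooted (p n)) ∧
      Tendsto (fun n => ExpType.ofPolynomial b (p n)) atTop (𝓝 f) := by
  obtain ⟨K, m, α, β, hα, -, hβ, hβs, hfz⟩ := hf
  lift α to ℝ≥0 using hα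
  lift β to ℕ → ℝ≥0 using hβ
  obtain ⟨c, hle, hc, hsum⟩ := exists_hasSum_of_tendsto_aeval
    (monotone_coeff_approxPoly m α β) (tendsto_aeval_approxPoly m α hβs)
  have hderiv : ∀ k, derivSeq f k = k.factorial * (K * algebraMap ℝ≥0 ℂ (c k)) :=
    derivSeq_of_hasSum fun z => by
      simpa only [hfz, mul_assoc] using (hsum z).mul_left K
  let p : ℕ → ℂ[X] := fun n => K • (approxPoly m α β n).map (algebraMap ℝ≥0 ℂ)
  have hp : ∀ n k, derivSeq (ofPolynomial b (p n)) k =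
      k.factorial * (K * algebraMap ℝ≥0 ℂ ((approxPoly m α β n).coeff k)) := fun n k => by
    refine (derivSeq_eval (p n) k).trans ?_
    rw [coeff_smul, coeff_map, smul_eq_mul]
  refine ⟨p, fun n => (nonposRooted_map_approxPoly m α β n).smul K,
    tendsto_of_dominated (fun n k => ?_) fun k => ?_⟩
  · simp only [hp, hderiv, norm_mul, norm_algebraMap_nnreal]
    gcongr
    exact hle n k
  · simp only [hp, hderiv]
    exact ((((continuous_algebraMap ℝ≥0 ℂ).tendsto _).comp (hc k)).const_mul K).const_mul _

end Approximation

theorem opMap_mem_laguerrePlus {θ ω a b : ℝ} (hθ : 0 ≤ θ) (hω : 0 ≤ ω) (ha : 0 ≤ a) (hb : 0 ≤ b)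
    (hab : b * expQuot a ω < 1) {φ : ExpType a} {f : ExpType b} (hφ : φ ∈ laguerrePlus a)
    (hf : f ∈ laguerrePlus b) : opMap hθ hω ha hb hab φ f ∈ laguerrePlus (outType a ω b) := by
  obtain ⟨p, hp, hpφ⟩ := ExpType.exists_tendsto_ofPolynomial hφ
  obtain ⟨q, hq, hqf⟩ := ExpType.exists_tendsto_ofPolynomial hf
  refine IsLaguerreEntire.of_tendsto (p := fun n => aeval (polyDelta θ ω) (p n) (q n))
    (fun n => (hp n).aeval_polyDelta hθ hω (hq n)) (opMap hθ hω ha hb hab φ f).2.1 fun z => ?_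
  simp only [← opMap_ofPolynomial hθ hω ha hb hab]
  have hlim := ((continuous_opMap hθ hω ha hb hab).tendsto (φ, f)).comp (hpφ.prodMk_nhds hqf)
  exact ((ExpType.continuous_apply z).tendsto _).comp hlim

end

theorem theorem2p3 (θ ω a b : ℝ) (hθ : 0 ≤ θ) (hω : 0 ≤ ω) (ha : 0 ≤ a) (hb : 0 ≤ b)
    (hab : b * expQuot a ω < 1) :
    ∃ T : laguerrePlus a × laguerrePlus b → laguerrePlus (outType a ω b),
      (∀ (φ : laguerrePlus a) (f : laguerrePlus b) (z : ℂ),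
        HasSum (opTerm θ ω (φ : ExpType a) (f : ExpType b) z)
          ((T (φ, f) : ExpType (outType a ω b)) z)) ∧
      Continuous T := by
  have hval : Continuous (Prod.map Subtype.val Subtype.val :
      laguerrePlus a × laguerrePlus b → ExpType a × ExpType b) :=
    continuous_subtype_val.prodMap continuous_subtype_val
  have hmem (q : laguerrePlus a × laguerrePlus b) :
      opMap hθ hω ha hb hab q.1 q.2 ∈ laguerrePlus (outType a ω b) :=
    opMap_mem_laguerrePlus hθ hω ha hb hab q.1.2 q.2.2
  exact ⟨fun q => ⟨opMap hθ hω ha hb hab q.1 q.2, hmem q⟩,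
    fun φ f z => hasSum_opTerm hθ hω ha hb hab φ f z,
    ((continuous_opMap hθ hω ha hb hab).comp hval).subtype_mk hmem⟩
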